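/- Let $N\ge 1$, let $\Omega\subset\mathbb R^N$ be a non-empty bounded convex open set with volume $|\Omega|$ and diameter $\operatorname{diam}(\Omega)$, let $d(x)=\operatorname{dist}(x,\partial\Omega)$, let $a_N$ be the volume of the unit ball of $\mathbb R^N$, let $1<p<\infty$ and let $k\ge 0$ be an integer. For $0<t\le 1$ put $X_1(t)=(1-\log t)^{-1}$, $X_i(t)=X_1(X_{i-1}(t))$ for $i\ge 2$, and $\eta(t)=\sum_{i=1}^k X_1(t)\cdots X_i(t)$ (so $\eta=0$ if $k=0$). For $D\ge\operatorname{diam}(\Omega)/2$ put $\eta_D=\eta\bigl(\operatorname{diam}(\Omega)/(2D)\bigr)$. Let $a=0$ if $1<p\le 2$ and $a=\frac{(p-2)k}{3(p-1)}$ if $p>2$, and let $$k_p=(p-1)\Bigl(\frac{p-1}{p}\Bigr)^p\,\frac{\sqrt{\pi}\,\Gamma\bigl(\frac{N+p}{2}\bigr)}{\Gamma\bigl(\frac{p+1}{2}\bigr)\Gamma\bigl(\frac N2\bigr)}.$$ Then there exists $D_0\ge\operatorname{diam}(\Omega)/2$, depending only on $k$, $p$ and $\operatorname{diam}(\Omega)$,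 such that for all $D\ge D_0$ one has $1-\eta_D-a\eta_D^2\ge 0$ and, for all $u\in W^{1,p}_0(\Omega)$, $$\int_\Omega|\nabla u|^p\,dx\ \ge\ \Bigl(\frac{p-1}{p}\Bigr)^p\int_\Omega\frac{|u|^p}{d^p}\,dx+\frac12\Bigl(\frac{p-1}{p}\Bigr)^{p-1}\sum_{i=1}^k\int_\Omega\frac{|u|^p}{d^p}X_1^2(d/D)\cdots X_i^2(d/D)\,dx+k_p\,(1-\eta_D-a\eta_D^2)^{\frac{p}{p-1}}\Bigl(\frac{a_N}{|\Omega|}\Bigr)^{\frac pN}\int_\Omega|u|^p\,dx .$$ When $p=2$ and $k\ge 1$, the equation $\eta_{D_0}=1$ has a unique solution $D_0\ge\operatorname{diam}(\Omega)/2$, and this $D_0$ can be taken. -/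

import Mathlib

open MeasureTheory Set
open scoped ENNReal ContDiff

noncomputable section

namespace RefinedHardy

/-- The function `X_1(t) = (1 - log t)⁻¹`, used for `0 < t ≤ 1`. -/
def X₁ (t : ℝ) : ℝ := (1 - Real.log t)⁻¹

/-- The iterated logarithmic functions: `X 1 = X₁` and `X k t = X₁ (X (k - 1) t)`.
The index `0` (the identity) only serves to start the recursion. -/
def X : ℕ → ℝ → ℝ
  | 0, t => t
  | k + 1, t => X₁ (X k t)

/-- `η(t) = ∑_{i=1}^k X_1(t) ⋯ X_i(t)`; it is `0` for `k = 0`. -/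
def eta (k : ℕ) (t : ℝ) : ℝ :=
  ∑ i ∈ Finset.Icc 1 k, ∏ j ∈ Finset.Icc 1 i, X j t

/-- `η_D = η(δ / (2D))`, where `δ` is the diameter of the domain. -/
def etaD (k : ℕ) (δ D : ℝ) : ℝ := eta k (δ / (2 * D))

/-- The constant `a`: zero for `1 < p ≤ 2` and `(p - 2) k / (3 (p - 1))` for `p > 2`. -/
def aConst (k : ℕ) (p : ℝ) : ℝ :=
  if p ≤ 2 then 0 else (p - 2) * k / (3 * (p - 1))

/-- The constant `k_p` in dimension `N`. -/
def kConst (N : ℕ) (p : ℝ) : ℝ :=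
  (p - 1) * ((p - 1) / p) ^ p *
    (Real.sqrt Real.pi * Real.Gamma ((N + p) / 2) /
      (Real.Gamma ((p + 1) / 2) * Real.Gamma (N / 2)))

/-- `a_N`, the volume of the unit ball of `ℝ^N`. -/
def ballVol (N : ℕ) : ℝ :=
  (volume : Measure (EuclideanSpace ℝ (Fin N))).real (Metric.ball 0 1)

variable {N : ℕ}

/-- `φ ∈ C_c^∞(Ω)`. -/
structure IsTestFunction (Ω : Set (EuclideanSpace ℝ (Fin N)))
    (φ : EuclideanSpace ℝ (Fin N) → ℝ) : Prop where
  smooth : ContDiff ℝ ∞ φ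
  compactSupport : HasCompactSupport φ
  support_subset : tsupport φ ⊆ Ω

/-- `G` is the weak (distributional) gradient of `u` in `Ω`. -/
structure IsWeakGradient (Ω : Set (EuclideanSpace ℝ (Fin N)))
    (u : EuclideanSpace ℝ (Fin N) → ℝ)
    (G : EuclideanSpace ℝ (Fin N) → EuclideanSpace ℝ (Fin N)) : Prop where
  locInt : LocallyIntegrableOn u Ω volume
  locInt_grad : LocallyIntegrableOn G Ω volume
  integral_eq : ∀ φ, IsTestFunction Ω φ →
    ∫ x in Ω, u x • gradient φ x = - ∫ x in Ω, φ x • G x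

/-- `u ∈ W_0^{1,p}(Ω)`: `u` belongs to `W^{1,p}(Ω)` and to the closure of `C_c^∞(Ω)` in it. -/
def MemW₀ (p : ℝ) (Ω : Set (EuclideanSpace ℝ (Fin N)))
    (u : EuclideanSpace ℝ (Fin N) → ℝ) : Prop :=
  ∃ G : EuclideanSpace ℝ (Fin N) → EuclideanSpace ℝ (Fin N),
    IsWeakGradient Ω u G ∧
    MemLp u (ENNReal.ofReal p) (volume.restrict Ω) ∧
    MemLp G (ENNReal.ofReal p) (volume.restrict Ω) ∧
    ∀ ε : ℝ≥0∞, 0 < ε → ∃ φ, IsTestFunction Ω φ ∧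
      eLpNorm (u - φ) (ENNReal.ofReal p) (volume.restrict Ω) +
        eLpNorm (G - gradient φ) (ENNReal.ofReal p) (volume.restrict Ω) < ε

/-- `d(x) = dist(x, ∂Ω)`. -/
def bdryDist (Ω : Set (EuclideanSpace ℝ (Fin N))) (x : EuclideanSpace ℝ (Fin N)) : ℝ :=
  Metric.infDist x (frontier Ω)

/-- The refined Hardy inequality for a function `u` with weak gradient `G`. The integrands are
nonnegative and the integrals are taken in `[0, ∞]`, so that the inequality includes the
finiteness of the integrals on its right-hand side when the left-hand side is finite. -/
def RefinedHardyIneq (k : ℕ) (p D : ℝ) (Ω : Set (EuclideanSpace ℝ (Fin N)))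
    (u : EuclideanSpace ℝ (Fin N) → ℝ)
    (G : EuclideanSpace ℝ (Fin N) → EuclideanSpace ℝ (Fin N)) : Prop :=
  (∫⁻ x in Ω, ENNReal.ofReal (‖G x‖ ^ p)) ≥
    ENNReal.ofReal (((p - 1) / p) ^ p) *
        (∫⁻ x in Ω, ENNReal.ofReal (|u x| ^ p / bdryDist Ω x ^ p))
    + ENNReal.ofReal (1 / 2 * ((p - 1) / p) ^ (p - 1)) *
        (∑ i ∈ Finset.Icc 1 k, (∫⁻ x in Ω, ENNReal.ofReal
          (|u x| ^ p / bdryDist Ω x ^ p *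
            ∏ j ∈ Finset.Icc 1 i, (X j (bdryDist Ω x / D)) ^ 2)))
    + ENNReal.ofReal
        (kConst N p *
          (1 - etaD k (Metric.diam Ω) D - aConst k p * (etaD k (Metric.diam Ω) D) ^ 2)
            ^ (p / (p - 1)) *
          (ballVol N / (volume : Measure (EuclideanSpace ℝ (Fin N))).real Ω) ^ (p / N)) *
        (∫⁻ x in Ω, ENNReal.ofReal (|u x| ^ p))

end RefinedHardy

end

/-!
The proof reduces the inequality to one dimension and averages over directions.

*One dimension.* On `(0, b)`, for `f` vanishing near `0`, Young's inequality and the fundamental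
theorem of calculus for `|f|^p T` give `∫ |f'|^p ≥ ∫ |f|^p (-T' - (p-1) T^{p/(p-1)})` for every
field `T ≥ 0`. The field used is `T = ((p-1)/p)^{p-1} (F(t) - F(b))` with
`F(t) = t^{1-p} (1 - η - a η²)`, `η = η(t/D)`. Since `(F(t) - F(b))^q ≤ F(t)^q - F(b)^q` for
`q = p/(p-1) ≥ 1`, the subtracted constant produces the term with `b^{-p}`, and what remains
follows from `t η'(t) = (η² + B)/2`, `B = ∑ X_1² ⋯ X_i²`, and a pointwise inequality between `η`
and `B` (`IsAdmissible`). For `p ≤ 2` this holds whenever `η ≤ 1`, by Bernoulli's inequality; for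
`p > 2` it holds for small `η`, because `η² ≤ k B` makes `a η B` dominate the cubic error
(`exists_isAdmissible`). As `η_D → 0` when `D → ∞`, this determines `D₀`; for `p = 2` the
condition is just `η_D ≤ 1`. The one-dimensional result is `interval_lintegral`.

*One direction.* Every line of direction `v` meets `Ω` in a chord, and integrating the
one-dimensional inequality over all lines gives an inequality for `∫ |∂_v φ|^p`
(`directional_inequality`). Its weight involves the distance to `∂Ω` along the line and the
half-length of the chord; both are expressed by the gauge of `Ω - y`. The logarithmic factors may
be evaluated at `d(y)`, which is at most the distance along the line.

*Average.* The inequality is integrated over `v` against `exp (-|v|²)`. Rotation invariance turns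
`|∂_v φ|^p` into a multiple of `|∇φ|^p` (`lintegral_inner_gaussian`). A supporting hyperplane at
the boundary point nearest to `y` bounds the mean of the distance weights below by the same
multiple of `d(y)^{-p}` (`le_lintegral_dirGauge`), and Jensen's inequality in polar coordinates
bounds the mean of the chord weights below by a power of `|Ω|` (`le_lintegral_chordGauge`).

*Closure.* Test functions approximate `u ∈ W_0^{1,p}`, and Fatou's lemma passes to the limit
(`MemW₀.lintegral_le`); the weak gradient is unique, so that any weak gradient of `u` may be used.
-/

namespace RefinedHardy

/-! ### Iterated logarithmic functions -/

lemma X_zero (t : ℝ) : X 0 t = t := rfl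

lemma X_succ (i : ℕ) (t : ℝ) : X (i + 1) t = X₁ (X i t) := rfl

lemma X₁_mem_Ioc {t : ℝ} (ht : t ∈ Ioc (0 : ℝ) 1) : X₁ t ∈ Ioc (0 : ℝ) 1 := by
  have h := Real.log_nonpos ht.1.le ht.2
  exact ⟨inv_pos.2 (by linarith), inv_le_one_of_one_le₀ (by linarith)⟩

lemma X_mem_Ioc (i : ℕ) {t : ℝ} (ht : t ∈ Ioc (0 : ℝ) 1) : X i t ∈ Ioc (0 : ℝ) 1 := by
  induction i with
  | zero => exact ht
  | succ i ih => exact X₁_mem_Ioc ih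

lemma X₁_monotoneOn : MonotoneOn X₁ (Ioc 0 1) := by
  intro s hs t ht hst
  have h1 := Real.log_nonpos ht.1.le ht.2
  have h2 := Real.log_le_log hs.1 hst
  exact inv_anti₀ (by linarith) (by linarith)

lemma X_monotoneOn (i : ℕ) : MonotoneOn (X i) (Ioc 0 1) := by
  induction i with
  | zero => exact fun _ _ _ _ h => h
  | succ i ih =>
    exact fun s hs t ht hst =>
      X₁_monotoneOn (X_mem_Ioc i hs) (X_mem_Ioc i ht) (ih hs ht hst)

lemma X_one (i : ℕ) : X i 1 = 1 := by
  induction i with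
  | zero => rfl
  | succ i ih => rw [X_succ, ih]; simp [X₁]

/-- The product `X_1(t) ⋯ X_i(t)`. -/
noncomputable def prodX (i : ℕ) (t : ℝ) : ℝ := ∏ j ∈ Finset.Icc 1 i, X j t

/-- The sum of squares `∑_{i=1}^k X_1²(t) ⋯ X_i²(t)`. -/
noncomputable def sumSq (k : ℕ) (t : ℝ) : ℝ := ∑ i ∈ Finset.Icc 1 k, prodX i t ^ 2

lemma prodX_zero (t : ℝ) : prodX 0 t = 1 := by simp [prodX]

lemma prodX_succ (i : ℕ) (t : ℝ) : prodX (i + 1) t = prodX i t * X (i + 1) t := by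
  simp [prodX, Finset.prod_Icc_succ_top]

lemma eta_zero (t : ℝ) : eta 0 t = 0 := by simp [eta]

lemma eta_succ (k : ℕ) (t : ℝ) : eta (k + 1) t = eta k t + prodX (k + 1) t := by
  simp [eta, prodX, Finset.sum_Icc_succ_top]

lemma eta_eq_sum (k : ℕ) (t : ℝ) : eta k t = ∑ i ∈ Finset.Icc 1 k, prodX i t := rfl

lemma sumSq_zero (t : ℝ) : sumSq 0 t = 0 := by simp [sumSq]

lemma sumSq_succ (k : ℕ) (t : ℝ) : sumSq (k + 1) t = sumSq k t + prodX (k + 1) t ^ 2 := by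
  simp [sumSq, Finset.sum_Icc_succ_top]

lemma sumSq_nonneg (k : ℕ) (t : ℝ) : 0 ≤ sumSq k t := Finset.sum_nonneg fun _ _ => sq_nonneg _

lemma prodX_pos (i : ℕ) {t : ℝ} (ht : t ∈ Ioc (0 : ℝ) 1) : 0 < prodX i t :=
  Finset.prod_pos fun j _ => (X_mem_Ioc j ht).1

lemma prodX_monotoneOn (i : ℕ) : MonotoneOn (prodX i) (Ioc 0 1) := fun _ hs _ ht hst =>
  Finset.prod_le_prod (fun j _ => (X_mem_Ioc j hs).1.le) fun j _ => X_monotoneOn j hs ht hst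

lemma sumSq_monotoneOn (k : ℕ) : MonotoneOn (sumSq k) (Ioc 0 1) := fun _ hs _ ht hst =>
  Finset.sum_le_sum fun i _ =>
    pow_le_pow_left₀ (prodX_pos i hs).le (prodX_monotoneOn i hs ht hst) 2

lemma eta_monotoneOn (k : ℕ) : MonotoneOn (eta k) (Ioc 0 1) := fun _ hs _ ht hst =>
  Finset.sum_le_sum fun i _ => prodX_monotoneOn i hs ht hst

lemma eta_nonneg (k : ℕ) {t : ℝ} (ht : t ∈ Ioc (0 : ℝ) 1) : 0 ≤ eta k t :=
  Finset.sum_nonneg fun i _ => (prodX_pos i ht).le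

lemma eta_one (k : ℕ) : eta k 1 = k := by
  simp [eta, X_one]

lemma prodX_le_X₁ {i : ℕ} (hi : 1 ≤ i) {t : ℝ} (ht : t ∈ Ioc (0 : ℝ) 1) :
    prodX i t ≤ X₁ t := by
  induction i, hi using Nat.le_induction with
  | base => simp [prodX, X]
  | succ i _ ih =>
    rw [prodX_succ]
    exact (mul_le_of_le_one_right (prodX_pos i ht).le (X_mem_Ioc _ ht).2).trans ih

lemma eta_le (k : ℕ) {t : ℝ} (ht : t ∈ Ioc (0 : ℝ) 1) : eta k t ≤ k * X₁ t := by
  rw [eta_eq_sum]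
  refine (Finset.sum_le_card_nsmul _ _ (X₁ t) fun i hi =>
    prodX_le_X₁ (Finset.mem_Icc.1 hi).1 ht).trans (by simp)

/-- By the Cauchy–Schwarz inequality. -/
lemma eta_sq_le (k : ℕ) (t : ℝ) : eta k t ^ 2 ≤ k * sumSq k t := by
  have h := sq_sum_le_card_mul_sum_sq (s := Finset.Icc 1 k) (f := fun i => prodX i t)
  simpa [eta_eq_sum, sumSq] using h

lemma X₁_hasDerivAt {t : ℝ} (ht : t ∈ Ioc (0 : ℝ) 1) :
    HasDerivAt X₁ (X₁ t ^ 2 / t) t := by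
  have h := Real.log_nonpos ht.1.le ht.2
  have h1 : (1 - Real.log t) ≠ 0 := by linarith
  have h2 := ((Real.hasDerivAt_log ht.1.ne').const_sub 1).inv h1
  refine h2.congr_deriv ?_
  simp only [X₁]
  field_simp

/-- The identity `t X_i'(t) = X_1(t) ⋯ X_{i-1}(t) X_i(t)²`. -/
lemma X_hasDerivAt (i : ℕ) {t : ℝ} (ht : t ∈ Ioc (0 : ℝ) 1) :
    HasDerivAt (X i) (prodX i t * X i t / t) t := by
  induction i with
  | zero =>
    have : prodX 0 t * X 0 t / t = 1 := by
      rw [prodX_zero, X_zero, one_mul, div_self ht.1.ne']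
    rw [this]
    exact hasDerivAt_id t
  | succ i ih =>
    have h := (X₁_hasDerivAt (X_mem_Ioc i ht)).comp t ih
    refine h.congr_deriv ?_
    have h0 := (X_mem_Ioc i ht).1.ne'
    have h1 := ht.1.ne'
    rw [prodX_succ, X_succ]
    field_simp

lemma prodX_hasDerivAt (i : ℕ) {t : ℝ} (ht : t ∈ Ioc (0 : ℝ) 1) :
    HasDerivAt (prodX i) (prodX i t * eta i t / t) t := by
  induction i with
  | zero =>
    rw [eta_zero, mul_zero, zero_div]
    exact (hasDerivAt_const t (1 : ℝ)).congr_of_eventuallyEq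
      (Filter.Eventually.of_forall prodX_zero)
  | succ i ih =>
    have h := (ih.mul (X_hasDerivAt (i + 1) ht)).congr_of_eventuallyEq
      (Filter.Eventually.of_forall (prodX_succ i))
    refine h.congr_deriv ?_
    rw [eta_succ, prodX_succ]
    ring

/-- The identity `t η'(t) = (η(t)² + ∑_{i=1}^k X_1²(t) ⋯ X_i²(t)) / 2`. -/
lemma eta_hasDerivAt (k : ℕ) {t : ℝ} (ht : t ∈ Ioc (0 : ℝ) 1) :
    HasDerivAt (eta k) ((eta k t ^ 2 + sumSq k t) / 2 / t) t := by
  induction k with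
  | zero =>
    rw [eta_zero, sumSq_zero]
    norm_num
    exact (hasDerivAt_const t (0 : ℝ)).congr_of_eventuallyEq
      (Filter.Eventually.of_forall eta_zero)
  | succ k ih =>
    have h := (ih.add (prodX_hasDerivAt (k + 1) ht)).congr_of_eventuallyEq
      (Filter.Eventually.of_forall (eta_succ k))
    refine h.congr_deriv ?_
    simp only [eta_succ, sumSq_succ]
    ring

lemma eta_continuousOn (k : ℕ) : ContinuousOn (eta k) (Ioc 0 1) := fun _ ht =>
  (eta_hasDerivAt k ht).continuousAt.continuousWithinAt

lemma sumSq_continuousOn (k : ℕ) : ContinuousOn (sumSq k) (Ioc 0 1) :=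
  continuousOn_finsetSum _ fun i _ =>
    (show ContinuousOn (prodX i) _ from fun _ ht =>
      (prodX_hasDerivAt i ht).continuousAt.continuousWithinAt).pow 2

lemma X_measurable (i : ℕ) : Measurable (X i) := by
  induction i with
  | zero => exact measurable_id
  | succ i ih => exact ((Real.measurable_log.comp ih).const_sub 1).inv

lemma prodX_measurable (i : ℕ) : Measurable (prodX i) :=
  Finset.measurable_fun_prod _ fun j _ => X_measurable j

lemma sumSq_measurable (k : ℕ) : Measurable (sumSq k) :=
  Finset.measurable_fun_sum _ fun i _ => (prodX_measurable i).pow_const 2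

lemma X₁_tendsto : Filter.Tendsto X₁ (nhdsWithin 0 (Ioi 0)) (nhds 0) := by
  refine Filter.Tendsto.inv_tendsto_atTop ?_
  simp only [sub_eq_add_neg]
  exact Filter.tendsto_atTop_add_const_left _ 1
    (Filter.tendsto_neg_atBot_atTop.comp Real.tendsto_log_nhdsGT_zero)

lemma div_two_mul_mem_Ioc {δ D : ℝ} (hδ : 0 < δ) (hD : δ / 2 ≤ D) :
    δ / (2 * D) ∈ Ioc (0 : ℝ) 1 := by
  have hD0 : 0 < D := by linarith
  exact ⟨by positivity, by rw [div_le_one (by positivity)]; linarith⟩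

lemma etaD_antitoneOn (k : ℕ) {δ : ℝ} (hδ : 0 < δ) :
    AntitoneOn (etaD k δ) (Ici (δ / 2)) := by
  intro D hD E hE h
  rw [mem_Ici] at hD hE
  refine eta_monotoneOn k (div_two_mul_mem_Ioc hδ hE) (div_two_mul_mem_Ioc hδ hD) ?_
  exact div_le_div_of_nonneg_left hδ.le (by linarith) (by linarith)

lemma etaD_nonneg (k : ℕ) {δ D : ℝ} (hδ : 0 < δ) (hD : δ / 2 ≤ D) : 0 ≤ etaD k δ D :=
  eta_nonneg k (div_two_mul_mem_Ioc hδ hD)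

lemma etaD_tendsto (k : ℕ) {δ : ℝ} (hδ : 0 < δ) :
    Filter.Tendsto (etaD k δ) Filter.atTop (nhds 0) := by
  have h1 : Filter.Tendsto (fun D : ℝ => δ / (2 * D)) Filter.atTop (nhdsWithin 0 (Ioi 0)) := by
    refine tendsto_nhdsWithin_iff.2 ⟨?_, ?_⟩
    · exact tendsto_const_nhds.div_atTop (Filter.tendsto_id.const_mul_atTop two_pos)
    · filter_upwards [Filter.eventually_gt_atTop 0] with D hD
      exact div_pos hδ (by linarith)
  have h2 : Filter.Tendsto (fun D : ℝ => (k : ℝ) * X₁ (δ / (2 * D))) Filter.atTop (nhds 0) := by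
    simpa using (X₁_tendsto.comp h1).const_mul (k : ℝ)
  refine tendsto_of_tendsto_of_tendsto_of_le_of_le' tendsto_const_nhds h2 ?_ ?_
  · filter_upwards [Filter.eventually_ge_atTop (δ / 2)] with D hD using etaD_nonneg k hδ hD
  · filter_upwards [Filter.eventually_ge_atTop (δ / 2)] with D hD
    exact eta_le k (div_two_mul_mem_Ioc hδ hD)

lemma exists_etaD_le (k : ℕ) {δ ε : ℝ} (hδ : 0 < δ) (hε : 0 < ε) :
    ∃ D, δ / 2 ≤ D ∧ etaD k δ D ≤ ε := by
  obtain ⟨D, h1, h2⟩ := ((Filter.eventually_ge_atTop (δ / 2)).and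
    ((etaD_tendsto k hδ).eventually_le_const hε)).exists
  exact ⟨D, h1, h2⟩

lemma eta_strictMonoOn {k : ℕ} (hk : 1 ≤ k) : StrictMonoOn (eta k) (Ioc 0 1) := by
  refine strictMonoOn_of_hasDerivWithinAt_pos (convex_Ioc 0 1) (eta_continuousOn k)
    (f' := fun t => (eta k t ^ 2 + sumSq k t) / 2 / t) (fun t ht => ?_) (fun t ht => ?_)
  · exact (eta_hasDerivAt k (interior_subset ht)).hasDerivWithinAt
  · have ht' : t ∈ Ioc (0 : ℝ) 1 := interior_subset ht
    have h0 : 0 < eta k t := Finset.sum_pos (fun i _ => prodX_pos i ht') (by simpa using hk)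
    have h1 := sumSq_nonneg k t
    have h2 := ht'.1
    positivity

lemma exists_etaD_eq_one {k : ℕ} (hk : 1 ≤ k) {δ : ℝ} (hδ : 0 < δ) :
    ∃ D, (δ / 2 ≤ D ∧ etaD k δ D = 1) ∧ ∀ E, δ / 2 ≤ E → etaD k δ E = 1 → E = D := by
  have h2 : δ / (2 * (δ / 2)) = 1 := by field_simp
  obtain ⟨E, hE, hE1⟩ := exists_etaD_le k hδ one_pos
  have hcont : ContinuousOn (etaD k δ) (Icc (δ / 2) E) := by
    refine (eta_continuousOn k).comp (f := fun D : ℝ => δ / (2 * D)) ?_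
      fun D hD => div_two_mul_mem_Ioc hδ hD.1
    refine continuousOn_const.div (by fun_prop) fun D hD => ?_
    have := hD.1
    exact (by linarith : (0:ℝ) < 2 * D).ne'
  obtain ⟨D, hD, hD1⟩ := intermediate_value_Icc' hE hcont
    (show (1 : ℝ) ∈ _ from ⟨hE1, by rw [etaD, h2, eta_one]; exact_mod_cast hk⟩)
  refine ⟨D, ⟨hD.1, hD1⟩, fun F hF hF1 => ?_⟩
  have h := (eta_strictMonoOn hk).injOn (div_two_mul_mem_Ioc hδ hF)
    (div_two_mul_mem_Ioc hδ hD.1) (hF1.trans hD1.symm)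
  have hF0 : 0 < F := by linarith
  have hD0 : 0 < D := by linarith [hD.1]
  field_simp at h
  linarith

/-! ### The algebraic inequality behind the Riccati supersolution -/

lemma aConst_nonneg (k : ℕ) {p : ℝ} : 0 ≤ aConst k p := by
  rw [aConst]
  split_ifs with h
  · exact le_rfl
  · have h2 : 0 < p - 2 := by linarith
    have : 0 < p - 1 := by linarith
    positivity

/-- `e` is admissible if the inequality making `t^{1-p} (1 - η - a η²)` a supersolution of the
Riccati equation holds for all values `η ≤ e` of the function `η` and all values `B` of
`∑ X_1² ⋯ X_i²` compatible with the Cauchy–Schwarz bound `η² ≤ k B`. -/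
def IsAdmissible (k : ℕ) (p e : ℝ) : Prop :=
  ∀ η B : ℝ, 0 ≤ η → η ≤ e → η ^ 2 ≤ k * B →
    0 ≤ 1 - η - aConst k p * η ^ 2 ∧
    (p - 1) * ((p - 1) / p) * (1 - η - aConst k p * η ^ 2) ^ (p / (p - 1)) + (p - 1) / p + B / 2 ≤
      (p - 1) * (1 - η - aConst k p * η ^ 2) + (1 + 2 * aConst k p * η) * ((η ^ 2 + B) / 2)

lemma IsAdmissible.mono {k : ℕ} {p e e' : ℝ} (h : IsAdmissible k p e) (he : e' ≤ e) :
    IsAdmissible k p e' := fun η B h0 h1 h2 => h η B h0 (h1.trans he) h2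

lemma hasDerivAt_one_sub_rpow {y s : ℝ} (hy : y < 1) :
    HasDerivAt (fun y : ℝ => (1 - y) ^ s) (-(s * (1 - y) ^ (s - 1))) y := by
  have h := ((hasDerivAt_id y).const_sub 1).rpow_const (p := s) (Or.inl (by simp; linarith))
  refine h.congr_deriv ?_
  simp

lemma le_of_hasDerivAt_nonneg {F F' : ℝ → ℝ} {b y : ℝ} (hc : ContinuousOn F (Icc 0 b))
    (hF : ∀ z ∈ Ioo 0 b, HasDerivAt F (F' z) z) (hF' : ∀ z ∈ Ioo 0 b, 0 ≤ F' z)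
    (hy : y ∈ Icc 0 b) : F 0 ≤ F y := by
  refine monotoneOn_of_hasDerivWithinAt_nonneg (f' := F') (convex_Icc 0 b) hc ?_ ?_
    ⟨le_rfl, hy.1.trans hy.2⟩ hy hy.1
  · rw [interior_Icc]; exact fun z hz => (hF z hz).hasDerivWithinAt
  · rw [interior_Icc]; exact hF'

/-- Integrating a lower bound for `(1 - z) ^ (1 / (p - 1))` gives one for the convexity defect of
`g ↦ g ^ (p / (p - 1))` at `g = 1 - y`. -/
lemma rpow_defect_lower_bound {p b κ y : ℝ} {n : ℕ} (hp : 1 < p) (hb : b ≤ 1)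
    (H : ∀ z ∈ Ioo 0 b, 1 - z / (p - 1) - κ * (n + 1) / (p - 1) * z ^ n ≤ (1 - z) ^ (1 / (p - 1)))
    (hy : y ∈ Icc 0 b) :
    -(y ^ 2 / 2) - κ * y ^ (n + 1) ≤
      (p - 1) * (1 - y) - (p - 1) * ((p - 1) / p) * (1 - y) ^ (p / (p - 1)) - (p - 1) / p := by
  have hp1 : 0 < p - 1 := by linarith
  have hp0 : 0 < p := by linarith
  have hq : 0 < p / (p - 1) := by positivity
  have key := le_of_hasDerivAt_nonneg (b := b) (y := y)
    (F := fun z => (p - 1) * (1 - z) - (p - 1) * ((p - 1) / p) * (1 - z) ^ (p / (p - 1))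
      - (p - 1) / p + z ^ 2 / 2 + κ * z ^ (n + 1))
    (F' := fun z => (p - 1) * ((1 - z) ^ (1 / (p - 1))
      - (1 - z / (p - 1) - κ * (n + 1) / (p - 1) * z ^ n))) ?_ ?_ ?_ hy
  · simp only [sub_zero, Real.one_rpow] at key
    have e0 : (p - 1) * 1 - (p - 1) * ((p - 1) / p) * 1 - (p - 1) / p = 0 := by
      field_simp; ring
    rw [e0] at key
    simp only [ne_eq, OfNat.ofNat_ne_zero, not_false_eq_true, zero_pow, zero_div,
      Nat.add_eq_zero_iff, one_ne_zero, and_false, mul_zero, add_zero] at key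
    linarith
  · have : Continuous fun z : ℝ => (1 - z) ^ (p / (p - 1)) :=
      Continuous.rpow_const (by fun_prop) fun _ => Or.inr hq.le
    exact Continuous.continuousOn (by fun_prop)
  · intro z hz
    have h1 := hasDerivAt_one_sub_rpow (s := p / (p - 1)) (hz.2.trans_le hb)
    have h2 := ((((((hasDerivAt_id z).const_sub 1).const_mul (p - 1)).sub
      (h1.const_mul ((p - 1) * ((p - 1) / p)))).sub_const ((p - 1) / p)).add
      (((hasDerivAt_id z).pow 2).div_const 2)).add (((hasDerivAt_id z).pow (n + 1)).const_mul κ)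
    refine h2.congr_deriv ?_
    have e : p / (p - 1) - 1 = 1 / (p - 1) := by field_simp; ring
    rw [e]
    simp
    field_simp
    ring
  · intro z hz
    exact mul_nonneg hp1.le (sub_nonneg.2 (H z hz))

lemma rpow_defect_lower_bound_of_le_two {p y : ℝ} (hp : 1 < p) (hp2 : p ≤ 2)
    (hy : y ∈ Icc (0 : ℝ) 1) : -(y ^ 2 / 2) ≤
      (p - 1) * (1 - y) - (p - 1) * ((p - 1) / p) * (1 - y) ^ (p / (p - 1)) - (p - 1) / p := by
  have hp1 : 0 < p - 1 := by linarith
  have h := rpow_defect_lower_bound (n := 0) (κ := 0) hp le_rfl (fun z hz => ?_) hy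
  · simpa using h
  · have := one_add_mul_self_le_rpow_one_add (s := -z) (by linarith [hz.2]) (p := 1 / (p - 1))
      (by rw [le_div_iff₀ hp1]; linarith)
    rw [← sub_eq_add_neg] at this
    refine le_trans (le_of_eq ?_) this
    ring

/-- For `0 < s < 1` the binomial expansion of `(1 - z) ^ s` at second order, with a slightly
increased constant. -/
lemma one_sub_rpow_lower_bound {s z : ℝ} (hs0 : 0 < s) (hs1 : s < 1)
    (hz : z ∈ Icc (0 : ℝ) (1 / 3)) :
    1 - s * z - 3 / 4 * (s * (1 - s)) * z ^ 2 ≤ (1 - z) ^ s := by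
  have key := le_of_hasDerivAt_nonneg (b := 1 / 3) (y := z)
    (F := fun z => (1 - z) ^ s - 1 + s * z + 3 / 4 * (s * (1 - s)) * z ^ 2)
    (F' := fun z => s * (1 + 3 / 2 * (1 - s) * z - (1 - z) ^ (s - 1))) ?_ ?_ ?_ hz
  · norm_num at key
    linarith
  · have : Continuous fun z : ℝ => (1 - z) ^ s :=
      Continuous.rpow_const (by fun_prop) fun _ => Or.inr hs0.le
    exact Continuous.continuousOn (by fun_prop)
  · intro z hz
    have h1 := hasDerivAt_one_sub_rpow (s := s) (y := z) (by linarith [hz.2])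
    have h2 := ((h1.sub_const 1).add ((hasDerivAt_id z).const_mul s)).add
      (((hasDerivAt_id z).pow 2).const_mul (3 / 4 * (s * (1 - s))))
    refine h2.congr_deriv ?_
    simp
    ring
  · intro z hz
    refine mul_nonneg hs0.le (sub_nonneg.2 ?_)
    have hz1 : 0 < 1 - z := by linarith [hz.2]
    have e : (1 - z) ^ (s - 1) = (1 + z / (1 - z)) ^ (1 - s) := by
      rw [show 1 + z / (1 - z) = (1 - z)⁻¹ by field_simp; ring, Real.inv_rpow hz1.le,
        ← Real.rpow_neg hz1.le, neg_sub]
    have hz2 : 0 ≤ z / (1 - z) := div_nonneg hz.1.le hz1.le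
    have h := rpow_one_add_le_one_add_mul_self (s := z / (1 - z)) (by linarith) (p := 1 - s)
      (by linarith) (by linarith)
    rw [e]
    refine h.trans ?_
    have h3 : z / (1 - z) ≤ 3 / 2 * z := by
      rw [div_le_iff₀ hz1]
      nlinarith [hz.1, hz.2]
    nlinarith

lemma isAdmissible_one_of_le_two {k : ℕ} {p : ℝ} (hp : 1 < p) (hp2 : p ≤ 2) :
    IsAdmissible k p 1 := by
  intro η B h0 h1 _
  have ha : aConst k p = 0 := if_pos hp2
  have h := rpow_defect_lower_bound_of_le_two hp hp2 ⟨h0, h1⟩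
  simp only [ha, zero_mul, sub_zero, mul_zero, add_zero, one_mul]
  exact ⟨by linarith, by linarith⟩

lemma exists_isAdmissible {k : ℕ} {p : ℝ} (hp : 1 < p) : ∃ e, 0 < e ∧ IsAdmissible k p e := by
  -- for `p > 2` the margin in the cubic terms is `σ/3 - σ/6`, where `σ` is defined below
  rcases le_or_gt p 2 with hp2 | hp2
  · exact ⟨1, one_pos, isAdmissible_one_of_le_two hp hp2⟩
  have hp1 : 0 < p - 1 := by linarith
  set a := aConst k p with ha_def
  have ha : a = (p - 2) * k / (3 * (p - 1)) := if_neg hp2.not_ge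
  have ha0 : 0 ≤ a := aConst_nonneg k
  -- `σ = 1 - 1 / (p - 1)` is the coefficient governing the third-order terms in `η`.
  set σ := (p - 2) / (p - 1) with hσ
  have hσ0 : 0 < σ := div_pos (by linarith) hp1
  have hs : 1 / (p - 1) = 1 - σ := by rw [hσ]; field_simp; ring
  have hak : a = σ / 3 * k := by rw [ha, hσ]; field_simp
  have h1 : ∀ᶠ η : ℝ in nhds 0, a ^ 2 * η / 2 + σ / 4 * (1 + a * η) ^ 3 < σ / 3 := by
    refine Filter.Tendsto.eventually_lt_const (v := σ / 4) (by linarith) ?_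
    exact (Continuous.tendsto' (by fun_prop) _ _ (by simp))
  have h2 : ∀ᶠ η : ℝ in nhds 0, η + a * η ^ 2 < 1 / 3 :=
    Filter.Tendsto.eventually_lt_const (v := 0) (by norm_num)
      (Continuous.tendsto' (by fun_prop) _ _ (by simp))
  obtain ⟨e, he, H⟩ := Metric.eventually_nhds_iff.1 (h1.and h2)
  refine ⟨e / 2, by positivity, fun η B hη0 hηe hB => ?_⟩
  obtain ⟨h3, h4⟩ := H (y := η) (by rw [Real.dist_eq, sub_zero, abs_of_nonneg hη0]; linarith)
  set y := η + a * η ^ 2 with hy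
  have hy0 : 0 ≤ y := by positivity
  have hg : 1 - η - a * η ^ 2 = 1 - y := by rw [hy]; ring
  rw [← ha_def, hg]
  refine ⟨by linarith, ?_⟩
  have h := rpow_defect_lower_bound (n := 2) (κ := σ / 4) (b := 1 / 3) hp (by norm_num)
    (fun z hz => ?_) ⟨hy0, h4.le⟩
  · have e1 : y ^ 2 / 2 = η ^ 2 / 2 + a * η ^ 3 + a ^ 2 * η ^ 4 / 2 := by rw [hy]; ring
    have e2 : y ^ (2 + 1) = η ^ 3 * (1 + a * η) ^ 3 := by rw [hy]; ring
    rw [e1, e2] at h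
    have h5 : η ^ 3 * (a ^ 2 * η / 2 + σ / 4 * (1 + a * η) ^ 3) ≤ η ^ 3 * (σ / 3) :=
      mul_le_mul_of_nonneg_left h3.le (by positivity)
    have h6 : σ / 3 * η * η ^ 2 ≤ σ / 3 * η * (k * B) :=
      mul_le_mul_of_nonneg_left hB (by positivity)
    have h7 : a * η * B = σ / 3 * η * (k * B) := by rw [hak]; ring
    nlinarith
  · have h5 := one_sub_rpow_lower_bound (s := 1 / (p - 1)) (by positivity)
      (by rw [hs]; linarith) ⟨hz.1.le, hz.2.le⟩
    refine le_trans (le_of_eq ?_) h5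
    have h6 : 1 - 1 / (p - 1) = σ := by rw [hs]; ring
    rw [h6]
    push_cast
    ring

/-! ### The one-dimensional inequality -/

/-- The vector field of the one-dimensional inequality before normalization:
`t^{1-p} (1 - η - a η²)` with `η = η(t/D)`. -/
noncomputable def hardyField (k : ℕ) (p D t : ℝ) : ℝ :=
  t ^ (1 - p) * (1 - eta k (t / D) - aConst k p * eta k (t / D) ^ 2)

lemma hardyField_hasDerivAt (k : ℕ) {p D t : ℝ} (hD : 0 < D) (ht : 0 < t)
    (htD : t ≤ D) :
    HasDerivAt (hardyField k p D)
      (-(t ^ (-p) * ((p - 1) * (1 - eta k (t / D) - aConst k p * eta k (t / D) ^ 2) +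
        (1 + 2 * aConst k p * eta k (t / D)) *
          ((eta k (t / D) ^ 2 + sumSq k (t / D)) / 2)))) t := by
  have hs : t / D ∈ Ioc (0 : ℝ) 1 := ⟨by positivity, (div_le_one hD).2 htD⟩
  have h1 := (eta_hasDerivAt k hs).comp t ((hasDerivAt_id t).div_const D)
  have h2 := ((h1.const_sub 1).sub ((h1.pow 2).const_mul (aConst k p)))
  have h3 := (Real.hasDerivAt_rpow_const (p := 1 - p) (Or.inl ht.ne')).mul h2
  refine h3.congr_deriv ?_
  simp only [Function.comp_apply, id_eq, Pi.pow_apply, Pi.sub_apply]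
  have e1 : t ^ (1 - p - 1) = t ^ (-p) := by congr 1; ring
  have e2 : t ^ (1 - p) = t * t ^ (-p) := by
    rw [sub_eq_add_neg, Real.rpow_add ht, Real.rpow_one]
  rw [e1, e2]
  field_simp
  ring

/-- Young's inequality in the form used in the vector field method. -/
lemma young_vector_field {p x y T : ℝ} (hp : 1 < p) (hT : 0 ≤ T) :
    p * |x| ^ (p - 2) * x * y * T ≤ |y| ^ p + (p - 1) * T ^ (p / (p - 1)) * |x| ^ p := by
  have hp1 : 0 < p - 1 := by linarith
  have hp0 : 0 < p := by linarith
  have hq : Real.HolderConjugate p (p / (p - 1)) := Real.HolderConjugate.conjExponent hp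
  have hY := Real.young_inequality_of_nonneg (abs_nonneg y)
    (b := |x| ^ (p - 1) * T) (by positivity) hq
  have e1 : (|x| ^ (p - 1) * T) ^ (p / (p - 1)) = |x| ^ p * T ^ (p / (p - 1)) := by
    rw [Real.mul_rpow (by positivity) hT, ← Real.rpow_mul (abs_nonneg x)]
    congr 2
    field_simp
  have e2 : |x| ^ (p - 2) * x ≤ |x| ^ (p - 1) ∧ -(|x| ^ (p - 2) * x) ≤ |x| ^ (p - 1) := by
    rcases eq_or_ne x 0 with rfl | hx
    · simp [Real.zero_rpow hp1.ne']
    · have : |x| ^ (p - 1) = |x| ^ (p - 2) * |x| := by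
        rw [← Real.rpow_add_one (abs_pos.2 hx).ne']; congr 1; ring
      rw [this, ← mul_neg]
      exact ⟨mul_le_mul_of_nonneg_left (le_abs_self x) (by positivity),
        mul_le_mul_of_nonneg_left (neg_le_abs x) (by positivity)⟩
  have e3 : |x| ^ (p - 2) * x * y ≤ |x| ^ (p - 1) * |y| := by
    refine (le_abs_self _).trans ?_
    rw [abs_mul]
    exact mul_le_mul_of_nonneg_right (abs_le'.2 e2) (abs_nonneg y)
  rw [e1] at hY
  have h4 := mul_le_mul_of_nonneg_left hY hp0.le
  have e5 : p * (|y| ^ p / p + |x| ^ p * T ^ (p / (p - 1)) / (p / (p - 1))) =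
      |y| ^ p + (p - 1) * T ^ (p / (p - 1)) * |x| ^ p := by field_simp
  rw [e5] at h4
  refine le_trans ?_ h4
  have h6 := mul_le_mul_of_nonneg_right (mul_le_mul_of_nonneg_left e3 hp0.le) hT
  nlinarith

/-- The weight of the one-dimensional inequality on an interval of half-length `b`, at distance
`t` from the nearest end point. -/
noncomputable def lineWeight (k : ℕ) (p e D b t : ℝ) : ℝ :=
  ((p - 1) / p) ^ p / t ^ p + 1 / 2 * ((p - 1) / p) ^ (p - 1) * sumSq k (t / D) / t ^ p +
    (p - 1) * ((p - 1) / p) ^ p * (1 - e - aConst k p * e ^ 2) ^ (p / (p - 1)) / b ^ p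

lemma defect_antitone (k : ℕ) {p η e : ℝ} (h0 : 0 ≤ η) (h : η ≤ e) :
    1 - e - aConst k p * e ^ 2 ≤ 1 - η - aConst k p * η ^ 2 := by
  have h1 := pow_le_pow_left₀ h0 h 2
  have h2 := mul_le_mul_of_nonneg_left h1 (aConst_nonneg k (p := p))
  linarith

lemma IsAdmissible.defect_nonneg {k : ℕ} {p e t : ℝ} (h : IsAdmissible k p e)
    (ht : t ∈ Ioc (0 : ℝ) 1) (he : eta k t ≤ e) :
    0 ≤ 1 - eta k t - aConst k p * eta k t ^ 2 :=
  (h _ _ (eta_nonneg k ht) he (eta_sq_le k t)).1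

/-- The field `T = ((p-1)/p)^{p-1} (F(t) - F(b))` with `F = hardyField` is a nonnegative
supersolution of the Riccati equation `-T' - (p-1) T^{p/(p-1)} = lineWeight`, because
`(A - B)^q ≤ A^q - B^q` for `A ≥ B ≥ 0` and `q ≥ 1`. -/
lemma lineWeight_le {k : ℕ} {p e D b t : ℝ} (hp : 1 < p) (hD : 0 < D) (hbD : b ≤ D)
    (ht : 0 < t) (htb : t ≤ b) (hadm : IsAdmissible k p e) (he : eta k (b / D) ≤ e)
    (hg : 0 ≤ 1 - e - aConst k p * e ^ 2) :
    0 ≤ ((p - 1) / p) ^ (p - 1) * (hardyField k p D t - hardyField k p D b) ∧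
    lineWeight k p e D b t + (p - 1) *
      (((p - 1) / p) ^ (p - 1) * (hardyField k p D t - hardyField k p D b)) ^ (p / (p - 1)) ≤
    ((p - 1) / p) ^ (p - 1) *
      (t ^ (-p) * ((p - 1) * (1 - eta k (t / D) - aConst k p * eta k (t / D) ^ 2) +
        (1 + 2 * aConst k p * eta k (t / D)) *
          ((eta k (t / D) ^ 2 + sumSq k (t / D)) / 2))) := by
  have hp1 : 0 < p - 1 := by linarith
  have hp0 : 0 < p := by linarith
  have hb : 0 < b := ht.trans_le htb
  have hq1 : 1 ≤ p / (p - 1) := by rw [le_div_iff₀ hp1]; linarith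
  have htm : t / D ∈ Ioc (0 : ℝ) 1 := ⟨by positivity, (div_le_one hD).2 (htb.trans hbD)⟩
  have hbm : b / D ∈ Ioc (0 : ℝ) 1 := ⟨by positivity, (div_le_one hD).2 hbD⟩
  have hηtb : eta k (t / D) ≤ eta k (b / D) :=
    eta_monotoneOn k htm hbm (div_le_div_of_nonneg_right htb hD.le)
  obtain ⟨hgt0, hineq⟩ := hadm _ (sumSq k (t / D)) (eta_nonneg k htm)
    (hηtb.trans he) (eta_sq_le k _)
  have hgtb := defect_antitone k (p := p) (eta_nonneg k htm) hηtb
  have hgbe := defect_antitone k (p := p) (eta_nonneg k hbm) he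
  have hFt : hardyField k p D t = t ^ (1 - p) *
    (1 - eta k (t / D) - aConst k p * eta k (t / D) ^ 2) := rfl
  have hFb : hardyField k p D b = b ^ (1 - p) *
    (1 - eta k (b / D) - aConst k p * eta k (b / D) ^ 2) := rfl
  set gt := 1 - eta k (t / D) - aConst k p * eta k (t / D) ^ 2
  set gb := 1 - eta k (b / D) - aConst k p * eta k (b / D) ^ 2
  set g := 1 - e - aConst k p * e ^ 2
  set B := sumSq k (t / D)
  set Z := (p - 1) * gt + (1 + 2 * aConst k p * eta k (t / D)) * ((eta k (t / D) ^ 2 + B) / 2)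
  set q := p / (p - 1) with hq
  set r := (p - 1) / p with hr
  have hr0 : 0 < r := by positivity
  have hpq : (1 - p) * q = -p := by rw [hq]; field_simp; ring
  have hFF : hardyField k p D b ≤ hardyField k p D t := by
    rw [hFt, hFb]
    exact mul_le_mul (Real.rpow_le_rpow_of_nonpos ht htb (by linarith)) hgtb
      (hg.trans hgbe) (by positivity)
  have hFb0 : 0 ≤ hardyField k p D b := by
    rw [hFb]; exact mul_nonneg (by positivity) (hg.trans hgbe)
  have hc : (r ^ (p - 1)) ^ q = r ^ p := by
    rw [← Real.rpow_mul hr0.le]; congr 1; rw [hq]; field_simp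
  have hcr : r ^ p = r ^ (p - 1) * r := by
    rw [← Real.rpow_add_one hr0.ne']; congr 1; ring
  refine ⟨mul_nonneg (by positivity) (sub_nonneg.2 hFF), ?_⟩
  have h1 : (hardyField k p D t - hardyField k p D b) ^ q + hardyField k p D b ^ q ≤
      hardyField k p D t ^ q := by
    have := Real.add_rpow_le_rpow_add (sub_nonneg.2 hFF) hFb0 hq1
    rwa [sub_add_cancel] at this
  have h2 : hardyField k p D t ^ q = t ^ (-p) * gt ^ q := by
    rw [hFt, Real.mul_rpow (by positivity) hgt0, ← Real.rpow_mul ht.le, hpq]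
  have h3 : b ^ (-p) * g ^ q ≤ hardyField k p D b ^ q := by
    rw [hFb, Real.mul_rpow (by positivity) (hg.trans hgbe), ← Real.rpow_mul hb.le, hpq]
    exact mul_le_mul_of_nonneg_left (Real.rpow_le_rpow hg hgbe (by linarith)) (by positivity)
  rw [Real.mul_rpow (by positivity) (sub_nonneg.2 hFF), hc]
  have h4 := mul_le_mul_of_nonneg_left hineq
    (show 0 ≤ r ^ (p - 1) * t ^ (-p) by positivity)
  have h5 : (p - 1) * (r ^ p * (hardyField k p D t - hardyField k p D b) ^ q) ≤
      (p - 1) * (r ^ p * (t ^ (-p) * gt ^ q - b ^ (-p) * g ^ q)) := by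
    refine mul_le_mul_of_nonneg_left (mul_le_mul_of_nonneg_left ?_ (by positivity)) hp1.le
    linarith
  have h6 : lineWeight k p e D b t = r ^ p * t ^ (-p) + 1 / 2 * r ^ (p - 1) * B * t ^ (-p) +
      (p - 1) * r ^ p * g ^ q * b ^ (-p) := by
    rw [lineWeight, Real.rpow_neg ht.le, Real.rpow_neg hb.le]
    rfl
  rw [h6]
  rw [hcr] at h5 ⊢
  nlinarith

lemma lineWeight_nonneg {k : ℕ} {p e D b t : ℝ} (hp : 1 < p) (ht : 0 ≤ t) (hb : 0 ≤ b)
    (hg : 0 ≤ 1 - e - aConst k p * e ^ 2) : 0 ≤ lineWeight k p e D b t := by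
  have hp1 : 0 < p - 1 := by linarith
  have := sumSq_nonneg k (t / D)
  rw [lineWeight]
  positivity

lemma lineWeight_continuousOn (k : ℕ) {p e D b ε : ℝ} (hD : 0 < D) (hbD : b ≤ D)
    (hε : 0 < ε) : ContinuousOn (lineWeight k p e D b) (Icc ε b) := by
  have h1 : ContinuousOn (fun t => sumSq k (t / D)) (Icc ε b) :=
    (sumSq_continuousOn k).comp (by fun_prop) fun t ht =>
      ⟨div_pos (hε.trans_le ht.1) hD, (div_le_one hD).2 (ht.2.trans hbD)⟩
  have h2 : ContinuousOn (fun t : ℝ => t ^ p) (Icc ε b) := fun t ht =>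
    (Real.continuousAt_rpow_const _ _ (Or.inl (hε.trans_le ht.1).ne')).continuousWithinAt
  have h3 : ∀ t ∈ Icc ε b, t ^ p ≠ 0 := fun t ht =>
    (Real.rpow_pos_of_pos (hε.trans_le ht.1) p).ne'
  unfold lineWeight
  exact ((continuousOn_const.div h2 h3).add ((continuousOn_const.mul h1).div h2 h3)).add
    continuousOn_const

/-- The refined Hardy inequality on the half interval `(0, b)`, for functions vanishing near `0`
but arbitrary at `b`. -/
lemma half_line_integral {k : ℕ} {p e D b ε : ℝ} (hp : 1 < p) (hD : 0 < D) (hbD : b ≤ D)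
    (hε : 0 < ε) (hεb : ε ≤ b) (hadm : IsAdmissible k p e) (he : eta k (b / D) ≤ e)
    (hg : 0 ≤ 1 - e - aConst k p * e ^ 2) {f f' : ℝ → ℝ} (hf : ∀ t, HasDerivAt f (f' t) t)
    (hf' : Continuous f') (h0 : f ε = 0) :
    ∫ t in ε..b, |f t| ^ p * lineWeight k p e D b t ≤ ∫ t in ε..b, |f' t| ^ p := by
  have hp0 : 0 < p := by linarith
  have hfc : Continuous f := continuous_iff_continuousAt.2 fun t => (hf t).continuousAt
  have hc1 : Continuous fun t => |f' t| ^ p :=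
    hf'.abs.rpow_const fun _ => Or.inr hp0.le
  have hc2 : ContinuousOn (fun t => |f t| ^ p * lineWeight k p e D b t) (Icc ε b) :=
    (hfc.abs.rpow_const fun _ => Or.inr hp0.le).continuousOn.mul
      (lineWeight_continuousOn k hD hbD hε)
  set c := ((p - 1) / p) ^ (p - 1)
  set T : ℝ → ℝ := fun t => c * (hardyField k p D t - hardyField k p D b) with hT
  have hTd : ∀ t, 0 < t → t ≤ b → HasDerivAt T _ t := fun t h h' =>
    ((hardyField_hasDerivAt k (p := p) hD h (h'.trans hbD)).sub_const _).const_mul c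
  have hfd : ∀ t, HasDerivAt (fun t => |f t| ^ p) (p * |f t| ^ (p - 2) * f t * f' t) t :=
    fun t => (hasDerivAt_abs_rpow (f t) hp).comp t (hf t)
  have key := intervalIntegral.sub_le_integral_of_hasDeriv_right_of_le
    (g := fun t => |f t| ^ p * T t)
    (φ := fun t => |f' t| ^ p - |f t| ^ p * lineWeight k p e D b t) hεb
    (fun t ht => ((hfd t).mul (hTd t (hε.trans_le ht.1)
      ht.2)).continuousAt.continuousWithinAt)
    (fun t ht => ((hfd t).mul (hTd t (hε.trans ht.1) ht.2.le)).hasDerivWithinAt)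
    ((hc1.continuousOn.sub hc2).integrableOn_Icc) (fun t ht => ?_)
  · have hTb : T b = 0 := by simp [hT]
    rw [h0, abs_zero, Real.zero_rpow hp0.ne', hTb, mul_zero, zero_mul, sub_zero,
      intervalIntegral.integral_sub (hc1.intervalIntegrable _ _)
        (hc2.intervalIntegrable_of_Icc hεb)] at key
    linarith
  · obtain ⟨h1, h2⟩ := lineWeight_le hp hD hbD (hε.trans ht.1) ht.2.le hadm he hg
    have h3 := young_vector_field (x := f t) (y := f' t) hp h1
    have h4 := mul_le_mul_of_nonneg_left h2
      (show 0 ≤ |f t| ^ p by positivity)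
    rw [mul_neg]
    simp only [hT]
    nlinarith

/-- The refined Hardy inequality on the half interval `(0, b)` as an inequality between Lebesgue
integrals. -/
lemma half_line_lintegral {k : ℕ} {p e D b ε : ℝ} (hp : 1 < p) (hD : 0 < D) (hbD : b ≤ D)
    (hε : 0 < ε) (hεb : ε ≤ b) (hadm : IsAdmissible k p e) (he : eta k (b / D) ≤ e)
    (hg : 0 ≤ 1 - e - aConst k p * e ^ 2) {f f' : ℝ → ℝ} (hf : ∀ t, HasDerivAt f (f' t) t)
    (hf' : Continuous f') (h0 : ∀ t ≤ ε, f t = 0) :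
    ∫⁻ t in Ioc 0 b, ENNReal.ofReal (|f t| ^ p * lineWeight k p e D b t) ≤
      ∫⁻ t in Ioc 0 b, ENNReal.ofReal (|f' t| ^ p) := by
  have hp0 : 0 < p := by linarith
  have hfc : Continuous f := continuous_iff_continuousAt.2 fun t => (hf t).continuousAt
  have hc1 : Continuous fun t => |f' t| ^ p :=
    hf'.abs.rpow_const fun _ => Or.inr hp0.le
  have hc2 : ContinuousOn (fun t => |f t| ^ p * lineWeight k p e D b t) (Icc ε b) :=
    (hfc.abs.rpow_const fun _ => Or.inr hp0.le).continuousOn.mul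
      (lineWeight_continuousOn k hD hbD hε)
  have h1 := half_line_integral hp hD hbD hε hεb hadm he hg hf hf' (h0 ε le_rfl)
  rw [intervalIntegral.integral_of_le hεb, intervalIntegral.integral_of_le hεb] at h1
  have h2 := ENNReal.ofReal_le_ofReal h1
  rw [ofReal_integral_eq_lintegral_ofReal (hc2.integrableOn_Icc.mono_set Ioc_subset_Icc_self),
    ofReal_integral_eq_lintegral_ofReal
      (hc1.continuousOn.integrableOn_Icc.mono_set Ioc_subset_Icc_self)] at h2
  · calc _ = ∫⁻ t in Ioc 0 ε ∪ Ioc ε b,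
          ENNReal.ofReal (|f t| ^ p * lineWeight k p e D b t) := by
            rw [Ioc_union_Ioc_eq_Ioc hε.le hεb]
      _ ≤ (∫⁻ t in Ioc 0 ε, ENNReal.ofReal (|f t| ^ p * lineWeight k p e D b t)) +
          ∫⁻ t in Ioc ε b, ENNReal.ofReal (|f t| ^ p * lineWeight k p e D b t) :=
            lintegral_union_le _ _ _
      _ = ∫⁻ t in Ioc ε b, ENNReal.ofReal (|f t| ^ p * lineWeight k p e D b t) := by
            rw [setLIntegral_congr_fun (g := fun _ => 0) measurableSet_Ioc, lintegral_zero,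
              zero_add]
            intro t ht
            simp [h0 t ht.2, Real.zero_rpow hp0.ne']
      _ ≤ ∫⁻ t in Ioc ε b, ENNReal.ofReal (|f' t| ^ p) := h2
      _ ≤ _ := lintegral_mono_set (Ioc_subset_Ioc_left hε.le)
  · exact Filter.Eventually.of_forall fun t => by simp only [Pi.zero_apply]; positivity
  · refine (ae_restrict_iff' measurableSet_Ioc).2 (Filter.Eventually.of_forall fun t ht => ?_)
    have := lineWeight_nonneg (k := k) (D := D) hp (hε.trans ht.1).le (hε.trans_le hεb).le hg
    simp only [Pi.zero_apply]
    positivity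

/-- The refined Hardy inequality on an interval `(α, β)`, for `C¹` functions vanishing near its
end points. -/
lemma interval_lintegral {k : ℕ} {p e D α β ε : ℝ} (hp : 1 < p) (hD : 0 < D)
    (hbD : (β - α) / 2 ≤ D)
    (hε : 0 < ε) (hαβ : α < β) (hadm : IsAdmissible k p e) (he : eta k ((β - α) / 2 / D) ≤ e)
    (hg : 0 ≤ 1 - e - aConst k p * e ^ 2) {f f' : ℝ → ℝ} (hf : ∀ t, HasDerivAt f (f' t) t)
    (hf' : Continuous f') (h0 : ∀ t ≤ α + ε, f t = 0) (h1 : ∀ t, β - ε ≤ t → f t = 0) :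
    ∫⁻ t in Ioo α β, ENNReal.ofReal
        (|f t| ^ p * lineWeight k p e D ((β - α) / 2) (min (β - t) (t - α))) ≤
      ∫⁻ t in Ioo α β, ENNReal.ofReal (|f' t| ^ p) := by
  set b := (β - α) / 2 with hb
  have hb0 : 0 < b := by rw [hb]; linarith
  set ε' := min ε b
  have hε' : 0 < ε' := lt_min hε hb0
  have hl := half_line_lintegral hp hD hbD hε' (min_le_right _ _) hadm he hg
    (f := fun t => f (α + t)) (f' := fun t => f' (α + t))
    (fun t => by simpa using (hf (α + t)).comp_const_add α t)
    (by fun_prop) (fun t ht => h0 _ (by linarith [min_le_left ε b]))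
  have hr := half_line_lintegral hp hD hbD hε' (min_le_right _ _) hadm he hg
    (f := fun t => f (β - t)) (f' := fun t => -f' (β - t))
    (fun t => (hf (β - t)).comp_const_sub β t)
    (by fun_prop) (fun t ht => h1 _ (by linarith [min_le_left ε b]))
  -- both halves of the interval are parametrized by the distance to the nearest end point
  have hL : ∀ F : ℝ → ℝ≥0∞, ∫⁻ t in Ioc 0 b, F (α + t) = ∫⁻ t in Ioc α (α + b), F t := by
    intro F
    rw [← lintegral_indicator measurableSet_Ioc, ← lintegral_indicator measurableSet_Ioc,
      ← lintegral_add_left_eq_self ((Ioc α (α + b)).indicator F) α]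
    refine lintegral_congr fun t => ?_
    simp only [indicator, mem_Ioc, lt_add_iff_pos_right, add_le_add_iff_left]
  have hR : ∀ F : ℝ → ℝ≥0∞, ∫⁻ t in Ioc 0 b, F (β - t) = ∫⁻ t in Ico (α + b) β, F t := by
    intro F
    rw [← lintegral_indicator measurableSet_Ioc, ← lintegral_indicator measurableSet_Ico,
      ← lintegral_sub_left_eq_self ((Ico (α + b) β).indicator F) β]
    refine lintegral_congr fun t => ?_
    have : t ∈ Ioc 0 b ↔ β - t ∈ Ico (α + b) β := by
      rw [mem_Ioc, mem_Ico]
      constructor <;> rintro ⟨h, h'⟩ <;> constructor <;> linarith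
    by_cases h : t ∈ Ioc 0 b
    · rw [indicator_of_mem h, indicator_of_mem (this.1 h)]
    · rw [indicator_of_notMem h, indicator_of_notMem (mt this.2 h)]
  set W : ℝ → ℝ≥0∞ := fun t =>
    ENNReal.ofReal (|f t| ^ p * lineWeight k p e D b (min (β - t) (t - α)))
  set V : ℝ → ℝ≥0∞ := fun t => ENNReal.ofReal (|f' t| ^ p)
  have hl' : ∫⁻ t in Ioc α (α + b), W t ≤ ∫⁻ t in Ioc α (α + b), V t := by
    rw [← hL, ← hL]
    refine le_trans (le_of_eq (setLIntegral_congr_fun measurableSet_Ioc fun t ht => ?_)) hl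
    have : min (β - (α + t)) (α + t - α) = t := by
      rw [min_eq_right] <;> linarith [ht.2]
    simp only [W, this]
  have hr' : ∫⁻ t in Ico (α + b) β, W t ≤ ∫⁻ t in Ico (α + b) β, V t := by
    rw [← hR, ← hR]
    refine le_trans (le_of_eq (setLIntegral_congr_fun measurableSet_Ioc fun t ht => ?_))
      (hr.trans (le_of_eq ?_))
    · have : min (β - (β - t)) (β - t - α) = t := by
        rw [min_eq_left] <;> linarith [ht.2]
      simp only [W, this]
    · simp only [V, abs_neg]
  have hU : Ioo α β = Ioo α (α + b) ∪ Ico (α + b) β :=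
    (Ioo_union_Ico_eq_Ioo (by linarith) (by linarith)).symm
  have hdisj : Disjoint (Ioo α (α + b)) (Ico (α + b) β) :=
    disjoint_left.2 fun t h h' => absurd h.2 (not_lt.2 h'.1)
  rw [hU, lintegral_union measurableSet_Ico hdisj, lintegral_union measurableSet_Ico hdisj,
    restrict_Ioo_eq_restrict_Ioc]
  exact add_le_add hl' hr'

/-! ### Chords of a convex set and the inequality in one direction -/

/-- The gauge (Minkowski functional) of `Ω` seen from `y ∈ Ω`. For `y ∈ Ω` and `v ≠ 0` it is the
inverse of the exit time `sup {s | y + s v ∈ Ω}`; it is set to `0` for `y ∉ Ω`. -/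
noncomputable def gaugeAt {E : Type*} [AddCommGroup E] [Module ℝ E] (Ω : Set E) (y v : E) : ℝ :=
  Ω.indicator (fun y => gauge ((fun z => y + z) ⁻¹' Ω) v) y

section Gauge

variable {E : Type*} [NormedAddCommGroup E] [InnerProductSpace ℝ E] {Ω : Set E}

lemma gaugeAt_nonneg (y v : E) : 0 ≤ gaugeAt Ω y v :=
  indicator_nonneg (fun _ _ => gauge_nonneg _) _

lemma gaugeAt_smul (y v : E) {c : ℝ} (hc : 0 ≤ c) :
    gaugeAt Ω y (c • v) = c * gaugeAt Ω y v := by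
  by_cases hy : y ∈ Ω
  · simp only [gaugeAt, indicator_of_mem hy, gauge_smul_of_nonneg hc, smul_eq_mul]
  · simp [gaugeAt, indicator_of_notMem hy]

lemma gaugeAt_lt_iff (hΩ : IsOpen Ω) (hc : Convex ℝ Ω) {y : E} (hy : y ∈ Ω) {c : ℝ}
    (h0 : 0 < c) (v : E) : gaugeAt Ω y v < c ↔ y + c⁻¹ • v ∈ Ω := by
  have h1 := setOfPred_gauge_lt_one_eq_self_of_isOpen
    (hc.translate_preimage_right y) (by simpa using hy) (hΩ.preimage (continuous_const_add y))
  have h2 : gaugeAt Ω y (c⁻¹ • v) < 1 ↔ y + c⁻¹ • v ∈ Ω := by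
    simp only [gaugeAt, indicator_of_mem hy]
    exact Set.ext_iff.1 h1 _
  rw [← h2, gaugeAt_smul _ _ (inv_pos.2 h0).le, inv_mul_lt_one₀ h0]

lemma gaugeAt_pos (hΩ : IsOpen Ω) (hb : Bornology.IsBounded Ω) {y v : E} (hy : y ∈ Ω)
    (hv : v ≠ 0) : 0 < gaugeAt Ω y v := by
  simp only [gaugeAt, indicator_of_mem hy]
  refine (gauge_pos (absorbent_nhds_zero ?_) ?_).2 hv
  · exact (hΩ.preimage (continuous_const_add y)).mem_nhds (by simpa using hy)
  · rw [NormedSpace.isVonNBounded_iff]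
    exact (IsometryEquiv.addLeft y).isometry.antilipschitz.isBounded_preimage hb

lemma gaugeAt_measurable [MeasurableSpace E] [BorelSpace E] [SecondCountableTopology E]
    (hΩ : IsOpen Ω) (hc : Convex ℝ Ω) :
    Measurable fun z : E × E => gaugeAt Ω z.1 z.2 := by
  refine measurable_of_Iio fun c => ?_
  rcases le_or_gt c 0 with h0 | h0
  · convert MeasurableSet.empty
    exact eq_empty_of_forall_notMem fun z hz =>
      absurd (lt_of_lt_of_le hz h0) (not_lt.2 (gaugeAt_nonneg _ _))
  · have : (fun z : E × E => gaugeAt Ω z.1 z.2) ⁻¹' Iio c =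
        (Prod.fst ⁻¹' Ωᶜ) ∪ (Prod.fst ⁻¹' Ω ∩ (fun z => z.1 + c⁻¹ • z.2) ⁻¹' Ω) := by
      ext z
      by_cases hz : z.1 ∈ Ω
      · simp [hz, gaugeAt_lt_iff hΩ hc hz h0]
      · simp [hz, gaugeAt, h0]
    rw [this]
    refine ((measurable_fst hΩ.measurableSet.compl)).union
      ((measurable_fst hΩ.measurableSet).inter ?_)
    exact (hΩ.preimage (by fun_prop)).measurableSet

/-- A line that meets a bounded open convex set does so in an open interval. -/
lemma exists_chord (hΩ : IsOpen Ω) (hc : Convex ℝ Ω) (hb : Bornology.IsBounded Ω) {x v : E}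
    (hv : v ≠ 0) (hx : ∃ s : ℝ, x + s • v ∈ Ω) :
    ∃ α β : ℝ, α < β ∧ ∀ s : ℝ, x + s • v ∈ Ω ↔ s ∈ Ioo α β := by
  obtain ⟨s₀, hs₀⟩ := hx
  have hI : ∀ s : ℝ, x + s • v = (x + s₀ • v) + (s - s₀) • v := fun s => by
    rw [add_assoc, ← add_smul]; congr 2; ring
  have hI' : ∀ s : ℝ, x + s • v = (x + s₀ • v) + (s₀ - s) • (-v) := fun s => by
    rw [smul_neg, ← neg_smul, neg_sub]; exact hI s
  have hg1 := gaugeAt_pos hΩ hb hs₀ hv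
  have hg2 := gaugeAt_pos hΩ hb hs₀ (neg_ne_zero.2 hv)
  refine ⟨s₀ - (gaugeAt Ω (x + s₀ • v) (-v))⁻¹, s₀ + (gaugeAt Ω (x + s₀ • v) v)⁻¹, ?_, ?_⟩
  · have := inv_pos.2 hg1
    have := inv_pos.2 hg2
    linarith
  · intro s
    rcases lt_trichotomy s s₀ with h | rfl | h
    · have h0 : 0 < s₀ - s := by linarith
      have h1 := gaugeAt_lt_iff hΩ hc hs₀ (inv_pos.2 h0) (-v)
      rw [inv_inv, ← hI', lt_inv_comm₀ hg2 h0] at h1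
      rw [← h1, mem_Ioo]
      have := inv_pos.2 hg1
      constructor
      · intro h'; constructor <;> linarith
      · intro h'; linarith [h'.1]
    · have := inv_pos.2 hg1
      have := inv_pos.2 hg2
      simp only [hs₀, true_iff]
      constructor <;> linarith
    · have h0 : 0 < s - s₀ := by linarith
      have h1 := gaugeAt_lt_iff hΩ hc hs₀ (inv_pos.2 h0) v
      rw [inv_inv, ← hI, lt_inv_comm₀ hg1 h0] at h1
      rw [← h1, mem_Ioo]
      have := inv_pos.2 hg2
      constructor
      · intro h'; constructor <;> linarith
      · intro h'; linarith [h'.2]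

variable {x v : E} {α β s : ℝ}

lemma eq_inv_of_forall_lt_iff {a b : ℝ} (hb : 0 < b)
    (h : ∀ c, 0 < c → (a < c ↔ c⁻¹ < b)) : a = b⁻¹ := by
  refine le_antisymm (le_of_forall_gt_imp_ge_of_dense fun c hc => ?_) (not_lt.1 fun hlt => ?_)
  · have hc0 : 0 < c := (inv_pos.2 hb).trans hc
    exact ((h c hc0).2 (inv_lt_of_inv_lt₀ hb hc)).le
  · exact absurd ((h _ (inv_pos.2 hb)).1 hlt) (by simp)

lemma gaugeAt_chord (hΩ : IsOpen Ω) (hc : Convex ℝ Ω)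
    (hI : ∀ s : ℝ, x + s • v ∈ Ω ↔ s ∈ Ioo α β) (hs : s ∈ Ioo α β) :
    gaugeAt Ω (x + s • v) v = (β - s)⁻¹ := by
  refine eq_inv_of_forall_lt_iff (sub_pos.2 hs.2) fun c h0 => ?_
  rw [gaugeAt_lt_iff hΩ hc ((hI s).2 hs) h0, add_assoc, ← add_smul, hI, mem_Ioo]
  have := inv_pos.2 h0
  exact ⟨fun h => by linarith [h.2], fun h => ⟨by linarith [hs.1], by linarith⟩⟩

lemma gaugeAt_chord_neg (hΩ : IsOpen Ω) (hc : Convex ℝ Ω)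
    (hI : ∀ s : ℝ, x + s • v ∈ Ω ↔ s ∈ Ioo α β) (hs : s ∈ Ioo α β) :
    gaugeAt Ω (x + s • v) (-v) = (s - α)⁻¹ := by
  refine eq_inv_of_forall_lt_iff (sub_pos.2 hs.1) fun c h0 => ?_
  rw [gaugeAt_lt_iff hΩ hc ((hI s).2 hs) h0, smul_neg, ← neg_smul, add_assoc, ← add_smul, hI,
    mem_Ioo]
  have := inv_pos.2 h0
  exact ⟨fun h => by linarith [h.1], fun h => ⟨by linarith, by linarith [hs.2]⟩⟩

lemma chord_endpoints_mem_closure (hαβ : α < β)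
    (hI : ∀ s : ℝ, x + s • v ∈ Ω ↔ s ∈ Ioo α β) (hs : s ∈ Icc α β) :
    x + s • v ∈ closure Ω := by
  rw [← closure_Ioo hαβ.ne] at hs
  exact map_mem_closure (f := fun s : ℝ => x + s • v) (by fun_prop) hs fun t ht => (hI t).2 ht

lemma chord_length_le_diam (hb : Bornology.IsBounded Ω) (hαβ : α < β)
    (hI : ∀ s : ℝ, x + s • v ∈ Ω ↔ s ∈ Ioo α β) :
    (β - α) * ‖v‖ ≤ Metric.diam Ω := by
  have h := Metric.dist_le_diam_of_mem hb.closure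
    (chord_endpoints_mem_closure hαβ hI (right_mem_Icc.2 hαβ.le))
    (chord_endpoints_mem_closure hαβ hI (left_mem_Icc.2 hαβ.le))
  rw [Metric.diam_closure, dist_add_left, dist_eq_norm, ← sub_smul, norm_smul, Real.norm_eq_abs,
    abs_of_pos (sub_pos.2 hαβ)] at h
  exact h

lemma chord_endpoint_mem_frontier (hΩ : IsOpen Ω) (hαβ : α < β)
    (hI : ∀ s : ℝ, x + s • v ∈ Ω ↔ s ∈ Ioo α β) (hs : s = α ∨ s = β) :
    x + s • v ∈ frontier Ω := by
  rw [hΩ.frontier_eq]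
  refine ⟨chord_endpoints_mem_closure hαβ hI ?_, fun h => ?_⟩
  · rcases hs with rfl | rfl
    · exact left_mem_Icc.2 hαβ.le
    · exact right_mem_Icc.2 hαβ.le
  · rcases hs with rfl | rfl
    · exact lt_irrefl _ ((hI _).1 h).1
    · exact lt_irrefl _ ((hI _).1 h).2

lemma infDist_frontier_chord_le (hΩ : IsOpen Ω) (hαβ : α < β)
    (hI : ∀ s : ℝ, x + s • v ∈ Ω ↔ s ∈ Ioo α β) (hs : s ∈ Ioo α β) :
    Metric.infDist (x + s • v) (frontier Ω) ≤ min (β - s) (s - α) * ‖v‖ := by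
  have key : ∀ t : ℝ, dist (x + s • v) (x + t • v) = |s - t| * ‖v‖ := fun t => by
    rw [dist_add_left, dist_eq_norm, ← sub_smul, norm_smul, Real.norm_eq_abs]
  rw [min_mul_of_nonneg _ _ (norm_nonneg v)]
  refine le_min ?_ ?_
  · have h := Metric.infDist_le_dist_of_mem (x := x + s • v)
      (chord_endpoint_mem_frontier hΩ hαβ hI (Or.inr rfl))
    rwa [key, abs_of_neg (by linarith [hs.2]), neg_sub] at h
  · have h := Metric.infDist_le_dist_of_mem (x := x + s • v)
      (chord_endpoint_mem_frontier hΩ hαβ hI (Or.inl rfl))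
    rwa [key, abs_of_pos (by linarith [hs.1])] at h

end Gauge

section Slicing

lemma lintegral_strip {E : Type*} [NormedAddCommGroup E] [InnerProductSpace ℝ E] {v : E}
    (hv : v ≠ 0) (x : E) :
    ∫⁻ s : ℝ, {y : E | inner ℝ y v ∈ Icc (0 : ℝ) 1}.indicator 1 (x - s • v) =
      ENNReal.ofReal (1 / ‖v‖ ^ 2) := by
  have hv2 : 0 < ‖v‖ ^ 2 := by positivity
  have h1 : (fun s : ℝ => {y : E | inner ℝ y v ∈ Icc (0 : ℝ) 1}.indicator
      (1 : E → ℝ≥0∞) (x - s • v)) =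
      (Icc ((inner ℝ x v - 1) / ‖v‖ ^ 2) (inner ℝ x v / ‖v‖ ^ 2)).indicator 1 := by
    ext s
    have : x - s • v ∈ {y : E | inner ℝ y v ∈ Icc (0 : ℝ) 1} ↔
        s ∈ Icc ((inner ℝ x v - 1) / ‖v‖ ^ 2) (inner ℝ x v / ‖v‖ ^ 2) := by
      rw [mem_ofPred_eq, inner_sub_left, real_inner_smul_left, real_inner_self_eq_norm_sq,
        mem_Icc, mem_Icc, div_le_iff₀ hv2, le_div_iff₀ hv2]
      constructor <;> rintro ⟨h, h'⟩ <;> constructor <;> linarith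
    by_cases h : s ∈ Icc ((inner ℝ x v - 1) / ‖v‖ ^ 2) (inner ℝ x v / ‖v‖ ^ 2)
    · rw [indicator_of_mem h, indicator_of_mem (this.2 h)]; rfl
    · rw [indicator_of_notMem h, indicator_of_notMem (mt this.1 h)]
  rw [h1, lintegral_indicator_one measurableSet_Icc, Real.volume_Icc]
  congr 1
  ring

variable {E : Type*} [NormedAddCommGroup E] [InnerProductSpace ℝ E] [FiniteDimensional ℝ E]
  [MeasurableSpace E] [BorelSpace E]

/-- An integral over `E` as an integral over the lines of direction `v`, each line being counted
according to the measure of the points at which it crosses the strip `0 ≤ ⟪y, v⟫ ≤ 1`. -/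
lemma lintegral_mul_eq_lintegral_lines {v : E} (hv : v ≠ 0) {F : E → ℝ≥0∞} (hF : Measurable F) :
    (∫⁻ x, F x) * ENNReal.ofReal (1 / ‖v‖ ^ 2) =
      ∫⁻ x, {y : E | inner ℝ y v ∈ Icc (0 : ℝ) 1}.indicator 1 x * ∫⁻ s : ℝ, F (x + s • v) := by
  set χ : E → ℝ≥0∞ := {y : E | inner ℝ y v ∈ Icc (0 : ℝ) 1}.indicator 1 with hχ
  have hχm : Measurable χ := by
    refine measurable_one.indicator ?_
    exact measurableSet_Icc.preimage (by fun_prop)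
  calc (∫⁻ x, F x) * ENNReal.ofReal (1 / ‖v‖ ^ 2)
      = ∫⁻ x, ∫⁻ s : ℝ, F x * χ (x - s • v) := by
        rw [← lintegral_mul_const _ hF]
        refine lintegral_congr fun x => ?_
        rw [lintegral_const_mul _ (by fun_prop), lintegral_strip hv]
    _ = ∫⁻ s : ℝ, ∫⁻ x, F x * χ (x - s • v) := lintegral_lintegral_swap (by fun_prop)
    _ = ∫⁻ s : ℝ, ∫⁻ x, F (x + s • v) * χ x := by
        refine lintegral_congr fun s => ?_
        rw [← lintegral_add_right_eq_self _ (s • v)]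
        simp only [add_sub_cancel_right]
    _ = ∫⁻ x, ∫⁻ s : ℝ, F (x + s • v) * χ x := lintegral_lintegral_swap (by fun_prop)
    _ = _ := by
        refine lintegral_congr fun x => ?_
        rw [lintegral_mul_const _ (by fun_prop), mul_comm]

lemma lintegral_le_of_lines {v : E} (hv : v ≠ 0) {F G : E → ℝ≥0∞} (hF : Measurable F)
    (hG : Measurable G) (h : ∀ x, ∫⁻ s : ℝ, F (x + s • v) ≤ ∫⁻ s : ℝ, G (x + s • v)) :
    ∫⁻ x, F x ≤ ∫⁻ x, G x := by
  have hv2 : 0 < 1 / ‖v‖ ^ 2 := by positivity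
  rw [← ENNReal.mul_le_mul_iff_left (ENNReal.ofReal_pos.2 hv2).ne' ENNReal.ofReal_ne_top,
    lintegral_mul_eq_lintegral_lines hv hF, lintegral_mul_eq_lintegral_lines hv hG]
  exact lintegral_mono fun x => mul_le_mul_right (h x) _

end Slicing

section Direction

variable {N : ℕ} {Ω : Set (EuclideanSpace ℝ (Fin N))}

/-- The inverse of the distance from `y` to `∂Ω` along the line of direction `v`, in units
of `v`. -/
noncomputable def dirGauge (Ω : Set (EuclideanSpace ℝ (Fin N)))
    (y v : EuclideanSpace ℝ (Fin N)) : ℝ :=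
  max (gaugeAt Ω y v) (gaugeAt Ω y (-v))

/-- The inverse of half the length of the chord of `Ω` through `y` of direction `v`, in units
of `v`: the harmonic mean of the gauges of `v` and `-v`. -/
noncomputable def chordGauge (Ω : Set (EuclideanSpace ℝ (Fin N)))
    (y v : EuclideanSpace ℝ (Fin N)) : ℝ :=
  2 * gaugeAt Ω y v * gaugeAt Ω y (-v) / (gaugeAt Ω y v + gaugeAt Ω y (-v))

/-- The weight of the Hardy inequality for the derivative in the direction `v`. -/
noncomputable def dirWeight (k : ℕ) (p e D : ℝ) (Ω : Set (EuclideanSpace ℝ (Fin N)))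
    (y v : EuclideanSpace ℝ (Fin N)) : ℝ :=
  (((p - 1) / p) ^ p + 1 / 2 * ((p - 1) / p) ^ (p - 1) * sumSq k (bdryDist Ω y / D)) *
      dirGauge Ω y v ^ p +
    (p - 1) * ((p - 1) / p) ^ p * (1 - e - aConst k p * e ^ 2) ^ (p / (p - 1)) *
      chordGauge Ω y v ^ p

lemma bdryDist_continuous : Continuous (bdryDist Ω) := Metric.continuous_infDist_pt _

lemma bdryDist_pos (hΩ : IsOpen Ω) (hfr : (frontier Ω).Nonempty)
    {y : EuclideanSpace ℝ (Fin N)} (hy : y ∈ Ω) : 0 < bdryDist Ω y := by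
  refine (isClosed_frontier.notMem_iff_infDist_pos hfr).1 fun h => ?_
  rw [hΩ.frontier_eq] at h
  exact h.2 hy

lemma dirGauge_measurable (hΩ : IsOpen Ω) (hc : Convex ℝ Ω) :
    Measurable fun z : EuclideanSpace ℝ (Fin N) × EuclideanSpace ℝ (Fin N) =>
      dirGauge Ω z.1 z.2 := by
  have h1 := gaugeAt_measurable hΩ hc
  have h2 := h1.comp (measurable_fst.prodMk measurable_snd.neg)
  exact h1.max h2

lemma chordGauge_measurable (hΩ : IsOpen Ω) (hc : Convex ℝ Ω) :
    Measurable fun z : EuclideanSpace ℝ (Fin N) × EuclideanSpace ℝ (Fin N) =>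
      chordGauge Ω z.1 z.2 := by
  have h1 := gaugeAt_measurable hΩ hc
  have h2 := h1.comp (measurable_fst.prodMk measurable_snd.neg)
  exact (((h1.const_mul 2).mul h2).div (h1.add h2))

lemma dirWeight_measurable (k : ℕ) (p e D : ℝ) (hΩ : IsOpen Ω) (hc : Convex ℝ Ω) :
    Measurable fun z : EuclideanSpace ℝ (Fin N) × EuclideanSpace ℝ (Fin N) =>
      dirWeight k p e D Ω z.1 z.2 := by
  have h1 := dirGauge_measurable hΩ hc
  have h2 := chordGauge_measurable hΩ hc
  have h3 : Measurable fun z : EuclideanSpace ℝ (Fin N) × EuclideanSpace ℝ (Fin N) =>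
      sumSq k (bdryDist Ω z.1 / D) :=
    (sumSq_measurable k).comp
      ((bdryDist_continuous.measurable.comp measurable_fst).div_const D)
  exact (((h3.const_mul _).const_add _).mul (h1.pow_const p)).add ((h2.pow_const p).const_mul _)

lemma dirGauge_chord (hΩ : IsOpen Ω) (hc : Convex ℝ Ω) {x v : EuclideanSpace ℝ (Fin N)}
    {α β s : ℝ} (hI : ∀ s : ℝ, x + s • v ∈ Ω ↔ s ∈ Ioo α β) (hs : s ∈ Ioo α β) :
    dirGauge Ω (x + s • v) v = (min (β - s) (s - α))⁻¹ := by
  have h1 : 0 < β - s := sub_pos.2 hs.2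
  have h2 : 0 < s - α := sub_pos.2 hs.1
  rw [dirGauge, gaugeAt_chord hΩ hc hI hs, gaugeAt_chord_neg hΩ hc hI hs]
  rcases le_total (β - s) (s - α) with h | h
  · rw [min_eq_left h, max_eq_left (inv_anti₀ h1 h)]
  · rw [min_eq_right h, max_eq_right (inv_anti₀ h2 h)]

lemma chordGauge_chord (hΩ : IsOpen Ω) (hc : Convex ℝ Ω) {x v : EuclideanSpace ℝ (Fin N)}
    {α β s : ℝ} (hI : ∀ s : ℝ, x + s • v ∈ Ω ↔ s ∈ Ioo α β) (hs : s ∈ Ioo α β) :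
    chordGauge Ω (x + s • v) v = ((β - α) / 2)⁻¹ := by
  have h1 : β - s ≠ 0 := (sub_pos.2 hs.2).ne'
  have h2 : s - α ≠ 0 := (sub_pos.2 hs.1).ne'
  have h3 : β - α ≠ 0 := by linarith [hs.1, hs.2]
  have h4 : (s - α) + (β - s) = β - α := by ring
  rw [chordGauge, gaugeAt_chord hΩ hc hI hs, gaugeAt_chord_neg hΩ hc hI hs,
    inv_add_inv h1 h2, add_comm (β - s), h4]
  field_simp

/-- On each line the directional weight is at most the weight of the one-dimensional inequality,
because the distance to `∂Ω` is at most the distance along the line. -/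
lemma dirWeight_le_lineWeight {k : ℕ} {p e D : ℝ} (hp : 1 < p) (hΩ : IsOpen Ω)
    (hc : Convex ℝ Ω) (hb : Bornology.IsBounded Ω) (hD : 0 < D)
    (hdD : Metric.diam Ω / 2 ≤ D) {x v : EuclideanSpace ℝ (Fin N)} (hv : v ≠ 0)
    {α β s : ℝ} (hI : ∀ s : ℝ, x + s • v ∈ Ω ↔ s ∈ Ioo α β) (hs : s ∈ Ioo α β) :
    dirWeight k p e D Ω (x + s • v) v ≤
      lineWeight k p e (D / ‖v‖) ((β - α) / 2) (min (β - s) (s - α)) := by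
  have hαβ : α < β := hs.1.trans hs.2
  have hv0 : 0 < ‖v‖ := norm_pos_iff.2 hv
  have ht : 0 < min (β - s) (s - α) := lt_min (sub_pos.2 hs.2) (sub_pos.2 hs.1)
  have htb : min (β - s) (s - α) ≤ (β - α) / 2 := by
    rcases le_total (β - s) (s - α) with h | h
    · rw [min_eq_left h]; linarith
    · rw [min_eq_right h]; linarith
  have hdist := infDist_frontier_chord_le hΩ hαβ hI hs
  have hdiam := chord_length_le_diam hb hαβ hI
  rw [dirWeight, dirGauge_chord hΩ hc hI hs, chordGauge_chord hΩ hc hI hs, lineWeight]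
  set t := min (β - s) (s - α)
  have hpos : 0 < bdryDist Ω (x + s • v) :=
    bdryDist_pos hΩ ⟨_, chord_endpoint_mem_frontier hΩ hαβ hI (Or.inr rfl)⟩ ((hI s).2 hs)
  have e1 : t / (D / ‖v‖) = t * ‖v‖ / D := by field_simp
  have htD : t * ‖v‖ / D ≤ 1 := by
    rw [div_le_one hD]
    have := mul_le_mul_of_nonneg_right htb hv0.le
    linarith
  have hle : bdryDist Ω (x + s • v) / D ≤ t / (D / ‖v‖) := by
    rw [e1]
    exact div_le_div_of_nonneg_right hdist hD.le
  have hS : sumSq k (bdryDist Ω (x + s • v) / D) ≤ sumSq k (t / (D / ‖v‖)) := by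
    refine sumSq_monotoneOn k ⟨by positivity, hle.trans (by rwa [e1])⟩
      ⟨by positivity, by rwa [e1]⟩ hle
  have hp1 : 0 < p - 1 := by linarith
  have hr : 0 < (p - 1) / p := div_pos hp1 (by linarith)
  rw [Real.inv_rpow ht.le, Real.inv_rpow (by linarith), div_eq_mul_inv (_ ^ p) (t ^ p),
    div_eq_mul_inv _ (((β - α) / 2) ^ p), div_eq_mul_inv _ (t ^ p), ← add_mul]
  gcongr

/-- The Hardy inequality on a line, for a test function. -/
lemma line_inequality {k : ℕ} {p e D : ℝ} (hp : 1 < p) (hΩ : IsOpen Ω)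
    (hc : Convex ℝ Ω) (hb : Bornology.IsBounded Ω) (hD : 0 < D)
    (hdD : Metric.diam Ω / 2 ≤ D) (hadm : IsAdmissible k p e)
    (he : etaD k (Metric.diam Ω) D ≤ e) (hg : 0 ≤ 1 - e - aConst k p * e ^ 2)
    {φ : EuclideanSpace ℝ (Fin N) → ℝ} (hφ : IsTestFunction Ω φ)
    {v : EuclideanSpace ℝ (Fin N)} (hv : v ≠ 0) (x : EuclideanSpace ℝ (Fin N)) :
    ∫⁻ s : ℝ, Ω.indicator (fun y => ENNReal.ofReal (|φ y| ^ p * dirWeight k p e D Ω y v))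
        (x + s • v) ≤
      ∫⁻ s : ℝ, Ω.indicator (fun y => ENNReal.ofReal (|fderiv ℝ φ y v| ^ p)) (x + s • v) := by
  by_cases hx : ∃ s : ℝ, x + s • v ∈ Ω
  swap
  · refine le_of_eq (lintegral_congr fun s => ?_)
    rw [indicator_of_notMem fun h => hx ⟨s, h⟩, indicator_of_notMem fun h => hx ⟨s, h⟩]
  obtain ⟨α, β, hαβ, hI⟩ := exists_chord hΩ hc hb hv hx
  have hv0 : 0 < ‖v‖ := norm_pos_iff.2 hv
  have hind : ∀ F : EuclideanSpace ℝ (Fin N) → ℝ≥0∞,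
      ∫⁻ s : ℝ, Ω.indicator F (x + s • v) = ∫⁻ s in Ioo α β, F (x + s • v) := by
    intro F
    rw [← lintegral_indicator measurableSet_Ioo]
    refine lintegral_congr fun s => ?_
    by_cases h : s ∈ Ioo α β
    · rw [indicator_of_mem h, indicator_of_mem ((hI s).2 h)]
    · rw [indicator_of_notMem h, indicator_of_notMem (mt (hI s).1 h)]
  have hdiam := chord_length_le_diam hb hαβ hI
  -- the support of the restriction of `φ` to the line is a compact subset of `(α, β)`
  obtain ⟨ε, hε, h0, h1⟩ : ∃ ε, 0 < ε ∧ (∀ s ≤ α + ε, φ (x + s • v) = 0) ∧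
      ∀ s, β - ε ≤ s → φ (x + s • v) = 0 := by
    have hK : IsClosed ((fun s : ℝ => x + s • v) ⁻¹' tsupport φ) :=
      (isClosed_tsupport φ).preimage (by fun_prop)
    have hsub : (fun s : ℝ => x + s • v) ⁻¹' tsupport φ ⊆ Ioo α β := fun s hs =>
      (hI s).1 (hφ.support_subset hs)
    have hn : ∀ γ, γ ∉ Ioo α β → ∃ ε, 0 < ε ∧ ∀ s, |s - γ| < ε → φ (x + s • v) = 0 := by
      intro γ hγ
      obtain ⟨ε, hε, h⟩ := Metric.isOpen_iff.1 hK.isOpen_compl γ fun h => hγ (hsub h)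
      exact ⟨ε, hε, fun s hs => image_eq_zero_of_notMem_tsupport (h hs)⟩
    have hout : ∀ s, s ∉ Ioo α β → φ (x + s • v) = 0 := fun s hs =>
      image_eq_zero_of_notMem_tsupport fun h => hs (hsub h)
    obtain ⟨ε₁, hε₁, H₁⟩ := hn α fun h => lt_irrefl _ h.1
    obtain ⟨ε₂, hε₂, H₂⟩ := hn β fun h => lt_irrefl _ h.2
    refine ⟨min ε₁ ε₂ / 2, by positivity, fun s hs => ?_, fun s hs => ?_⟩
    · rcases le_or_gt s α with h | h
      · exact hout s fun h' => absurd h'.1 (not_lt.2 h)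
      · refine H₁ s ?_
        rw [abs_of_pos (by linarith)]
        linarith [min_le_left ε₁ ε₂]
    · rcases le_or_gt β s with h | h
      · exact hout s fun h' => absurd h'.2 (not_lt.2 h)
      · refine H₂ s ?_
        rw [abs_of_neg (by linarith)]
        linarith [min_le_right ε₁ ε₂]
  have hφd : Differentiable ℝ φ := hφ.smooth.differentiable (by simp)
  have hder : ∀ s : ℝ, HasDerivAt (fun s : ℝ => φ (x + s • v)) (fderiv ℝ φ (x + s • v) v) s := by
    intro s
    have h2 : HasDerivAt (fun s : ℝ => x + s • v) v s := by
      simpa using ((hasDerivAt_id s).smul_const v).const_add x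
    exact (hφd (x + s • v)).hasFDerivAt.comp_hasDerivAt s h2
  have hcont : Continuous fun s : ℝ => fderiv ℝ φ (x + s • v) v :=
    ((hφ.smooth.continuous_fderiv (by simp)).comp (by fun_prop)).clm_apply continuous_const
  have hbD : (β - α) / 2 ≤ D / ‖v‖ := by
    rw [le_div_iff₀ hv0]; linarith
  have hdpos : 0 < Metric.diam Ω := lt_of_lt_of_le (mul_pos (sub_pos.2 hαβ) hv0) hdiam
  have heb : eta k ((β - α) / 2 / (D / ‖v‖)) ≤ e := by
    refine le_trans (eta_monotoneOn k ⟨?_, ?_⟩ (div_two_mul_mem_Ioc hdpos hdD) ?_) he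
    · have := sub_pos.2 hαβ
      positivity
    · rw [div_le_one (by positivity)]; exact hbD
    · have : (β - α) / 2 / (D / ‖v‖) = (β - α) * ‖v‖ / (2 * D) := by field_simp
      rw [this]
      exact div_le_div_of_nonneg_right hdiam (by linarith)
  have key := interval_lintegral hp (div_pos hD hv0) hbD hε hαβ hadm heb hg hder hcont h0 h1
  rw [hind, hind]
  refine le_trans (setLIntegral_mono' measurableSet_Ioo fun s hs => ?_) key
  exact ENNReal.ofReal_le_ofReal (mul_le_mul_of_nonneg_left
    (dirWeight_le_lineWeight hp hΩ hc hb hD hdD hv hI hs) (by positivity))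

/-- The Hardy inequality for the derivative in the direction `v`, for a test function. -/
lemma directional_inequality {k : ℕ} {p e D : ℝ} (hp : 1 < p) (hΩ : IsOpen Ω)
    (hc : Convex ℝ Ω) (hb : Bornology.IsBounded Ω) (hD : 0 < D)
    (hdD : Metric.diam Ω / 2 ≤ D) (hadm : IsAdmissible k p e)
    (he : etaD k (Metric.diam Ω) D ≤ e) (hg : 0 ≤ 1 - e - aConst k p * e ^ 2)
    {φ : EuclideanSpace ℝ (Fin N) → ℝ} (hφ : IsTestFunction Ω φ)
    {v : EuclideanSpace ℝ (Fin N)} (hv : v ≠ 0) :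
    ∫⁻ y in Ω, ENNReal.ofReal (|φ y| ^ p * dirWeight k p e D Ω y v) ≤
      ∫⁻ y in Ω, ENNReal.ofReal (|fderiv ℝ φ y v| ^ p) := by
  rw [← lintegral_indicator hΩ.measurableSet, ← lintegral_indicator hΩ.measurableSet]
  refine lintegral_le_of_lines hv ?_ ?_
    fun x => line_inequality hp hΩ hc hb hD hdD hadm he hg hφ hv x
  · refine Measurable.indicator ?_ hΩ.measurableSet
    have h1 : Measurable φ := hφ.smooth.continuous.measurable
    have h0 := dirWeight_measurable k p e D hΩ hc
    have h2 := h0.comp (measurable_prodMk_right (y := v))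
    exact (((h1.abs.pow_const p).mul h2)).ennreal_ofReal
  · refine Measurable.indicator ?_ hΩ.measurableSet
    have h1 : Measurable fun y => fderiv ℝ φ y v :=
      ((hφ.smooth.continuous_fderiv (by simp)).clm_apply continuous_const).measurable
    exact (h1.abs.pow_const p).ennreal_ofReal

end Direction

/-! ### Gaussian averages over directions -/

section Polar

variable {E : Type*} [NormedAddCommGroup E] [NormedSpace ℝ E] [FiniteDimensional ℝ E]
  [MeasurableSpace E] [BorelSpace E] [Nontrivial E]

lemma lintegral_volumeIoiPow (n : ℕ) {F : ℝ → ℝ≥0∞} (hF : Measurable F) :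
    ∫⁻ r, F r ∂(Measure.volumeIoiPow n) = ∫⁻ r in Ioi (0 : ℝ), ENNReal.ofReal (r ^ n) * F r := by
  rw [Measure.volumeIoiPow, lintegral_withDensity_eq_lintegral_mul _ (by fun_prop) (by fun_prop)]
  exact lintegral_subtype_comap measurableSet_Ioi fun r => ENNReal.ofReal (r ^ n) * F r

/-- Integration in polar coordinates. -/
lemma lintegral_polar (μ : Measure E) [μ.IsAddHaarMeasure] {F : E → ℝ≥0∞} (hF : Measurable F) :
    ∫⁻ x, F x ∂μ = ∫⁻ θ, ∫⁻ r, F ((r : ℝ) • (θ : E))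
      ∂(Measure.volumeIoiPow (Module.finrank ℝ E - 1)) ∂μ.toSphere := by
  calc ∫⁻ x, F x ∂μ = ∫⁻ x : ({(0)}ᶜ : Set E), F x ∂(μ.comap (↑)) := by
        rw [lintegral_subtype_comap (measurableSet_singleton _).compl F, restrict_compl_singleton]
    _ = ∫⁻ z : (Metric.sphere (0 : E) 1) × (Ioi (0 : ℝ)), F ((z.2 : ℝ) • (z.1 : E))
        ∂(μ.toSphere.prod (Measure.volumeIoiPow (Module.finrank ℝ E - 1))) := by
        rw [← μ.measurePreserving_homeomorphUnitSphereProd.lintegral_comp_emb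
          (Homeomorph.measurableEmbedding _)]
        refine lintegral_congr fun x => ?_
        rw [← homeomorphUnitSphereProd_symm_apply_coe, Homeomorph.symm_apply_apply]
    _ = _ := lintegral_prod _ (by fun_prop)

lemma lintegral_Ioi_rpow_mul_exp_neg_sq {s : ℝ} (hs : -1 < s) :
    ∫⁻ r in Ioi (0 : ℝ), ENNReal.ofReal (r ^ s * Real.exp (-r ^ 2)) =
      ENNReal.ofReal (1 / 2 * Real.Gamma ((s + 1) / 2)) := by
  have h := integral_rpow_mul_exp_neg_rpow two_pos hs
  have hint : IntegrableOn (fun r : ℝ => r ^ s * Real.exp (-r ^ 2)) (Ioi 0) := by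
    simpa using (integrable_rpow_mul_exp_neg_mul_sq one_pos hs).integrableOn
  simp only [Real.rpow_two] at h
  rw [← h, ofReal_integral_eq_lintegral_ofReal hint]
  filter_upwards [ae_restrict_mem measurableSet_Ioi] with r hr
  have : 0 < r := hr
  simp only [Pi.zero_apply]
  positivity

/-- The Gaussian integral of a function homogeneous of degree `p` in terms of its integral over
the unit sphere. -/
lemma lintegral_homogeneous_gaussian (μ : Measure E) [μ.IsAddHaarMeasure] {p : ℝ} (hp : 0 < p)
    {f : E → ℝ} (hf : Measurable f)
    (hhom : ∀ (r : ℝ) (x : E), 0 < r → f (r • x) = r ^ p * f x) :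
    ∫⁻ x, ENNReal.ofReal (f x * Real.exp (-‖x‖ ^ 2)) ∂μ =
      ENNReal.ofReal (1 / 2 * Real.Gamma ((Module.finrank ℝ E + p) / 2)) *
        ∫⁻ θ : Metric.sphere (0 : E) 1, ENNReal.ofReal (f θ) ∂μ.toSphere := by
  have hn : 0 < Module.finrank ℝ E := Module.finrank_pos
  rw [lintegral_polar μ (by fun_prop), ← lintegral_const_mul _ (by fun_prop)]
  refine lintegral_congr fun θ => ?_
  have hθ : ‖(θ : E)‖ = 1 := by simp
  set s : ℝ := Module.finrank ℝ E - 1 + p with hs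
  have hs1 : -1 < s := by
    have : (1 : ℝ) ≤ Module.finrank ℝ E := by exact_mod_cast hn
    linarith
  have e : (Module.finrank ℝ E + p) / 2 = (s + 1) / 2 := by rw [hs]; ring
  rw [e, ← lintegral_Ioi_rpow_mul_exp_neg_sq hs1, ← lintegral_mul_const _ (by fun_prop),
    lintegral_volumeIoiPow _
      (F := fun r => ENNReal.ofReal (f (r • (θ : E)) * Real.exp (-‖r • (θ : E)‖ ^ 2)))
      (by fun_prop)]
  refine setLIntegral_congr_fun measurableSet_Ioi fun r hr => ?_
  have hr0 : 0 < r := hr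
  rw [← ENNReal.ofReal_mul (by positivity), ← ENNReal.ofReal_mul (by positivity), hhom r _ hr0,
    norm_smul, hθ, mul_one, Real.norm_eq_abs, sq_abs]
  congr 1
  have : r ^ s = r ^ (Module.finrank ℝ E - 1) * r ^ p := by
    rw [hs, Real.rpow_add hr0, ← Real.rpow_natCast, Nat.cast_pred hn]
  rw [this]
  ring

/-- The volume of a set star-shaped about `0` in terms of its gauge. -/
lemma measure_gauge_lt_one (μ : Measure E) [μ.IsAddHaarMeasure] {γ : E → ℝ} (hγ : Measurable γ)
    (hpos : ∀ x, x ≠ 0 → 0 < γ x) (hhom : ∀ (r : ℝ) (x : E), 0 < r → γ (r • x) = r * γ x) :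
    μ {x | γ x < 1} = ∫⁻ θ : Metric.sphere (0 : E) 1,
      ENNReal.ofReal ((γ θ)⁻¹ ^ Module.finrank ℝ E / Module.finrank ℝ E) ∂μ.toSphere := by
  have hn : 0 < Module.finrank ℝ E := Module.finrank_pos
  have hm : MeasurableSet {x | γ x < 1} := measurableSet_lt hγ measurable_const
  rw [← lintegral_indicator_one hm, lintegral_polar μ (measurable_one.indicator hm)]
  refine lintegral_congr fun θ => ?_
  have hθ : (θ : E) ≠ 0 := ne_zero_of_mem_unit_sphere θ
  have h1 := Measure.volumeIoiPow_apply_Iio (Module.finrank ℝ E - 1)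
    ⟨(γ θ)⁻¹, inv_pos.2 (hpos _ hθ)⟩
  rw [Nat.sub_add_cancel hn, Nat.cast_pred hn, sub_add_cancel] at h1
  rw [← h1, ← lintegral_indicator_one measurableSet_Iio]
  refine lintegral_congr fun r => ?_
  have : (r : ℝ) • (θ : E) ∈ {x | γ x < 1} ↔
      r ∈ Iio (⟨(γ θ)⁻¹, inv_pos.2 (hpos _ hθ)⟩ : Ioi (0 : ℝ)) := by
    rw [mem_ofPred_eq, hhom _ _ r.2, mem_Iio, ← Subtype.coe_lt_coe]
    change _ ↔ (r : ℝ) < (γ θ)⁻¹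
    rw [← one_div, lt_div_iff₀ (hpos _ hθ)]
  by_cases h : r ∈ Iio (⟨(γ θ)⁻¹, inv_pos.2 (hpos _ hθ)⟩ : Ioi (0:ℝ))
  · rw [indicator_of_mem h, indicator_of_mem (this.2 h)]; rfl
  · rw [indicator_of_notMem h, indicator_of_notMem (mt this.1 h)]

end Polar

section Gaussian

variable {N : ℕ}

/-- The constant `∫ |⟨w, v⟩|^p exp (-|v|²) dv` for unit vectors `w` of `ℝ^N`. -/
noncomputable def gaussConst (N : ℕ) (p : ℝ) : ℝ :=
  Real.Gamma ((p + 1) / 2) * √Real.pi ^ (N - 1)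

lemma gaussConst_pos (N : ℕ) {p : ℝ} (hp : 0 < p) : 0 < gaussConst N p := by
  have := Real.Gamma_pos_of_pos (show 0 < (p + 1) / 2 by positivity)
  have := Real.pi_pos
  rw [gaussConst]
  positivity

lemma integral_abs_rpow_mul_exp_neg_sq {p : ℝ} (hp : 0 < p) :
    ∫ x : ℝ, |x| ^ p * Real.exp (-x ^ 2) = Real.Gamma ((p + 1) / 2) := by
  have h1 := integral_comp_abs (f := fun x : ℝ => x ^ p * Real.exp (-x ^ 2))
  have h2 := integral_rpow_mul_exp_neg_rpow two_pos (show -1 < p by linarith)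
  simp only [Real.rpow_two] at h2
  simp only [sq_abs] at h1
  rw [h1, h2]
  ring

lemma integral_coordinate_gaussian (n : ℕ) {p : ℝ} (hp : 0 < p) :
    ∫ v : EuclideanSpace ℝ (Fin (n + 1)), |v 0| ^ p * Real.exp (-‖v‖ ^ 2) =
      gaussConst (n + 1) p := by
  have h1 := (PiLp.volume_preserving_ofLp (Fin (n + 1))).integral_comp'
    (f := (MeasurableEquiv.toLp 2 (Fin (n + 1) → ℝ)).symm)
    (fun x : Fin (n + 1) → ℝ => |x 0| ^ p * Real.exp (-∑ i, x i ^ 2))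
  have h2 := integral_fintype_prod_volume_eq_prod (𝕜 := ℝ) (E := fun _ : Fin (n + 1) => ℝ)
    (fun i x => if i = 0 then |x| ^ p * Real.exp (-x ^ 2) else Real.exp (-x ^ 2))
  have h3 : ∀ x : Fin (n + 1) → ℝ, |x 0| ^ p * Real.exp (-∑ i, x i ^ 2) =
      ∏ i, if i = 0 then |x i| ^ p * Real.exp (-x i ^ 2) else Real.exp (-x i ^ 2) := by
    intro x
    rw [← Finset.sum_neg_distrib, Real.exp_sum, Fin.prod_univ_succ, Fin.prod_univ_succ]
    simp [Fin.succ_ne_zero, mul_assoc]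
  have h4 : ∀ v : EuclideanSpace ℝ (Fin (n + 1)), ‖v‖ ^ 2 = ∑ i, v i ^ 2 := fun v => by
    simp [EuclideanSpace.norm_sq_eq]
  have h5 : ∫ x : ℝ, Real.exp (-x ^ 2) = √Real.pi := by
    simpa using integral_gaussian 1
  simp only [h4]
  refine h1.trans ?_
  simp only [h3]
  rw [h2, Fin.prod_univ_succ]
  simp [Fin.succ_ne_zero, h5, integral_abs_rpow_mul_exp_neg_sq hp, gaussConst]

lemma lintegral_inner_gaussian (hN : 0 < N) {p : ℝ} (hp : 0 < p) (w : EuclideanSpace ℝ (Fin N)) :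
    ∫⁻ v : EuclideanSpace ℝ (Fin N),
      ENNReal.ofReal (|inner ℝ w v| ^ p * Real.exp (-‖v‖ ^ 2)) =
      ENNReal.ofReal (gaussConst N p * ‖w‖ ^ p) := by
  obtain ⟨n, rfl⟩ : ∃ n, N = n + 1 := ⟨N - 1, by omega⟩
  set e : EuclideanSpace ℝ (Fin (n + 1)) := EuclideanSpace.single 0 ‖w‖ with he
  have hnorm : ‖w‖ = ‖e‖ := by simp [he]
  set R := (Submodule.span ℝ {w - e})ᗮ.reflection
  have hR : R w = e := Submodule.reflection_sub hnorm
  have h0 := integral_coordinate_gaussian n hp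
  have hint : Integrable fun v : EuclideanSpace ℝ (Fin (n + 1)) =>
      |v 0| ^ p * Real.exp (-‖v‖ ^ 2) := by
    refine Integrable.of_integral_ne_zero ?_
    rw [h0]
    exact (gaussConst_pos _ hp).ne'
  calc _ = ∫⁻ v : EuclideanSpace ℝ (Fin (n + 1)),
        ENNReal.ofReal (|inner ℝ e v| ^ p * Real.exp (-‖v‖ ^ 2)) := by
        rw [← R.measurePreserving.lintegral_comp_emb R.toHomeomorph.measurableEmbedding
          (fun v => ENNReal.ofReal (|inner ℝ e v| ^ p * Real.exp (-‖v‖ ^ 2)))]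
        refine lintegral_congr fun v => ?_
        rw [← hR, R.inner_map_map, R.norm_map]
    _ = ∫⁻ v : EuclideanSpace ℝ (Fin (n + 1)),
        ENNReal.ofReal (‖w‖ ^ p) * ENNReal.ofReal (|v 0| ^ p * Real.exp (-‖v‖ ^ 2)) := by
        refine lintegral_congr fun v => ?_
        rw [← ENNReal.ofReal_mul (by positivity), he, EuclideanSpace.inner_single_left]
        simp only [conj_trivial, abs_mul, abs_norm]
        rw [Real.mul_rpow (norm_nonneg _) (abs_nonneg _), mul_assoc]
    _ = _ := by
        rw [lintegral_const_mul' _ _ ENNReal.ofReal_ne_top,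
          ← ofReal_integral_eq_lintegral_ofReal hint
            (Filter.Eventually.of_forall fun v => by simp only [Pi.zero_apply]; positivity),
          h0, ← ENNReal.ofReal_mul (by positivity), mul_comm]

end Gaussian

section Averages

variable {N : ℕ} {Ω : Set (EuclideanSpace ℝ (Fin N))}

lemma ballVol_eq (hN : 0 < N) : ballVol N = √Real.pi ^ N / Real.Gamma (N / 2 + 1) := by
  have : Nonempty (Fin N) := ⟨⟨0, hN⟩⟩
  have h : 0 < Real.Gamma ((N : ℝ) / 2 + 1) := Real.Gamma_pos_of_pos (by positivity)
  rw [ballVol, measureReal_def, EuclideanSpace.volume_ball]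
  simp only [ENNReal.ofReal_one, one_pow, one_mul, Fintype.card_fin]
  exact ENNReal.toReal_ofReal (by positivity)

/-- At every point of a convex open set there is a unit vector `n` (the normal of a supporting
hyperplane at a nearest boundary point) such that `Ω` lies in a half space with normal `n`
whose boundary is at distance at most `d(y)` from `y`. -/
lemma exists_unit_normal (hΩ : IsOpen Ω) (hc : Convex ℝ Ω) (hb : Bornology.IsBounded Ω)
    (hfr : (frontier Ω).Nonempty) {y : EuclideanSpace ℝ (Fin N)} (hy : y ∈ Ω) :
    ∃ n : EuclideanSpace ℝ (Fin N), ‖n‖ = 1 ∧ ∀ z ∈ Ω, inner ℝ n (z - y) < bdryDist Ω y := by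
  have hcomp : IsCompact (frontier Ω) :=
    Metric.isCompact_of_isClosed_isBounded isClosed_frontier
      (hb.closure.subset frontier_subset_closure)
  obtain ⟨y₀, hy₀, hd⟩ := hcomp.exists_infDist_eq_dist hfr y
  have hy₀' : y₀ ∉ Ω := by
    rw [hΩ.frontier_eq] at hy₀
    exact hy₀.2
  obtain ⟨f, hf⟩ := geometric_hahn_banach_open_point hc hΩ hy₀'
  set m := (InnerProductSpace.toDual ℝ (EuclideanSpace ℝ (Fin N))).symm f with hm
  have hfm : ∀ z, f z = inner ℝ m z := fun z => by
    rw [hm, InnerProductSpace.toDual_symm_apply]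
  have hm0 : m ≠ 0 := by
    intro h0
    have := hf y hy
    rw [hfm, hfm, h0, inner_zero_left, inner_zero_left] at this
    exact lt_irrefl _ this
  have hmn : 0 < ‖m‖ := norm_pos_iff.2 hm0
  refine ⟨‖m‖⁻¹ • m, by rw [norm_smul, norm_inv, norm_norm, inv_mul_cancel₀ hmn.ne'], ?_⟩
  intro z hz
  have h1 : inner ℝ m (z - y) < inner ℝ m (y₀ - y) := by
    rw [inner_sub_right, inner_sub_right, ← hfm, ← hfm, ← hfm]
    linarith [hf z hz]
  have h2 : inner ℝ m (y₀ - y) ≤ ‖m‖ * bdryDist Ω y := by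
    refine (real_inner_le_norm _ _).trans (le_of_eq ?_)
    rw [bdryDist, hd, dist_comm, dist_eq_norm]
  rw [real_inner_smul_left, inv_mul_lt_iff₀ hmn]
  exact h1.trans_le h2

lemma abs_inner_le_dirGauge (hΩ : IsOpen Ω) (hc : Convex ℝ Ω)
    {y n : EuclideanSpace ℝ (Fin N)} {d : ℝ} (hd : 0 < d) (hy : y ∈ Ω)
    (hn : ∀ z ∈ Ω, inner ℝ n (z - y) < d) (v : EuclideanSpace ℝ (Fin N)) :
    |inner ℝ n v| ≤ d * dirGauge Ω y v := by
  have key : ∀ v, inner ℝ n v ≤ d * gaugeAt Ω y v := by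
    intro v
    by_contra! h
    have h1 : gaugeAt Ω y v < inner ℝ n v / d := by rwa [lt_div_iff₀ hd, mul_comm]
    have h2 : 0 < inner ℝ n v / d := (gaugeAt_nonneg _ _).trans_lt h1
    have h3 := hn _ ((gaugeAt_lt_iff hΩ hc hy h2 v).1 h1)
    rw [add_sub_cancel_left, real_inner_smul_right] at h3
    have h4 : inner ℝ n v ≠ 0 := by
      intro h0
      rw [h0, zero_div] at h2
      exact lt_irrefl _ h2
    field_simp at h3
    exact lt_irrefl _ h3
  refine abs_le'.2 ⟨(key v).trans (mul_le_mul_of_nonneg_left (le_max_left _ _) hd.le), ?_⟩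
  have := key (-v)
  rw [inner_neg_right] at this
  exact this.trans (mul_le_mul_of_nonneg_left (le_max_right _ _) hd.le)

/-- The Gaussian mean of the inverse `p`-th power of the distance to `∂Ω` along lines bounds
`1 / d^p` from above: since `Ω` lies in a half space at distance at most `d` from `y`, the
distance in the direction `v` is at most `d / |⟪n, v⟫|` for the unit normal `n`. -/
lemma le_lintegral_dirGauge (hN : 0 < N) {p : ℝ} (hp : 0 < p) (hΩ : IsOpen Ω)
    (hc : Convex ℝ Ω) (hb : Bornology.IsBounded Ω) (hfr : (frontier Ω).Nonempty)
    {y : EuclideanSpace ℝ (Fin N)} (hy : y ∈ Ω) :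
    ENNReal.ofReal (gaussConst N p / bdryDist Ω y ^ p) ≤
      ∫⁻ v : EuclideanSpace ℝ (Fin N),
        ENNReal.ofReal (dirGauge Ω y v ^ p * Real.exp (-‖v‖ ^ 2)) := by
  obtain ⟨n, hn1, hn⟩ := exists_unit_normal hΩ hc hb hfr hy
  have hd := bdryDist_pos hΩ hfr hy
  set d := bdryDist Ω y
  have h1 := lintegral_inner_gaussian hN hp n
  rw [hn1, Real.one_rpow, mul_one] at h1
  rw [div_eq_mul_inv, mul_comm, ENNReal.ofReal_mul (by positivity), ← h1,
    ← lintegral_const_mul' _ _ ENNReal.ofReal_ne_top]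
  refine lintegral_mono fun v => ?_
  rw [← ENNReal.ofReal_mul (by positivity)]
  refine ENNReal.ofReal_le_ofReal ?_
  rw [← mul_assoc]
  refine mul_le_mul_of_nonneg_right ?_ (Real.exp_pos _).le
  rw [inv_mul_le_iff₀ (by positivity)]
  refine (Real.rpow_le_rpow (abs_nonneg _) (abs_inner_le_dirGauge hΩ hc hd hy hn v)
    hp.le).trans (le_of_eq ?_)
  exact Real.mul_rpow hd.le (le_max_of_le_left (gaugeAt_nonneg _ _))

/-- The tangent line inequality for the convex function `Y ↦ Y^{-s}` at `Y = Y₀`. -/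
lemma tangent_line_rpow_neg {s Y Y₀ : ℝ} (hs : 0 ≤ s) (hY : 0 < Y) (hY₀ : 0 < Y₀) :
    (1 + s) * Y₀ ^ (-s) ≤ Y ^ (-s) + s * Y₀ ^ (-s) / Y₀ * Y := by
  have h1 : Y ^ (-s) = Y₀ ^ (-s) * (Y / Y₀) ^ (-s) := by
    rw [← Real.mul_rpow hY₀.le (by positivity)]; congr 1; field_simp
  have h2 : 1 + s - s * (Y / Y₀) ≤ (Y / Y₀) ^ (-s) := by
    have ht : 0 < Y / Y₀ := by positivity
    rw [Real.rpow_def_of_pos ht]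
    have h3 := Real.add_one_le_exp (Real.log (Y / Y₀) * -s)
    have h4 := mul_le_mul_of_nonneg_left (Real.log_le_sub_one_of_pos ht) hs
    linarith
  have h3 := mul_le_mul_of_nonneg_left h2 (show 0 ≤ Y₀ ^ (-s) by positivity)
  rw [h1]
  have h4 : s * Y₀ ^ (-s) / Y₀ * Y = Y₀ ^ (-s) * (s * (Y / Y₀)) := by ring
  rw [h4]
  linarith

/-- The tangent line inequality at the half-length `b` of a chord, with `b^N` replaced by the mean
of the `N`-th powers of the two exit times, which is larger by convexity. -/
lemma chord_tangent_line (hN : 0 < N) {p g₁ g₂ Y₀ : ℝ} (hp : 0 < p) (h₁ : 0 < g₁) (h₂ : 0 < g₂)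
    (hY₀ : 0 < Y₀) :
    (1 + p / N) * Y₀ ^ (-(p / N)) ≤ (2 * g₁ * g₂ / (g₁ + g₂)) ^ p +
      (p / N * Y₀ ^ (-(p / N)) / Y₀ / 2 * g₁⁻¹ ^ N +
        p / N * Y₀ ^ (-(p / N)) / Y₀ / 2 * g₂⁻¹ ^ N) := by
  have hN0 : (0 : ℝ) < N := by exact_mod_cast hN
  set Y := (g₁⁻¹ ^ N + g₂⁻¹ ^ N) / 2 with hY
  have hY0 : 0 < Y := by positivity
  have h3 := tangent_line_rpow_neg (s := p / N) (by positivity) hY0 hY₀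
  set b := (g₁⁻¹ + g₂⁻¹) / 2 with hbdef
  have hb : 0 < b := by positivity
  have h4 : b ^ N ≤ Y := by
    have hconv := (convexOn_pow N).2 (inv_pos.2 h₁).le (inv_pos.2 h₂).le
      (show (0 : ℝ) ≤ 1 / 2 by norm_num) (show (0 : ℝ) ≤ 1 / 2 by norm_num) (by norm_num)
    simp only [smul_eq_mul] at hconv
    calc b ^ N = (1 / 2 * g₁⁻¹ + 1 / 2 * g₂⁻¹) ^ N := by rw [hbdef]; congr 1; ring
      _ ≤ _ := hconv
      _ = Y := by rw [hY]; ring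
  have h5 : (2 * g₁ * g₂ / (g₁ + g₂)) ^ p = (b ^ N) ^ (-(p / N)) := by
    have : 2 * g₁ * g₂ / (g₁ + g₂) = b⁻¹ := by rw [hbdef]; field_simp; ring
    rw [this, ← Real.rpow_natCast, ← Real.rpow_mul hb.le, Real.inv_rpow hb.le,
      ← Real.rpow_neg hb.le]
    congr 1
    field_simp
  have h6 : Y ^ (-(p / N)) ≤ (b ^ N) ^ (-(p / N)) :=
    Real.rpow_le_rpow_of_nonpos (by positivity) h4 (by simp; positivity)
  rw [h5]
  have h7 : p / N * Y₀ ^ (-(p / N)) / Y₀ / 2 * g₁⁻¹ ^ N +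
      p / N * Y₀ ^ (-(p / N)) / Y₀ / 2 * g₂⁻¹ ^ N = p / N * Y₀ ^ (-(p / N)) / Y₀ * Y := by rw [hY]; ring
  rw [h7]
  linarith

/-- The integral of the `N`-th power of the exit time over the sphere is `N |Ω|`, for the directions
`θ` as well as for their opposites. -/
lemma lintegral_sphere_gaugeAt (hN : 0 < N) (hΩ : IsOpen Ω) (hc : Convex ℝ Ω)
    (hb : Bornology.IsBounded Ω) {y : EuclideanSpace ℝ (Fin N)} (hy : y ∈ Ω)
    {σ : ℝ} (hσ : σ = 1 ∨ σ = -1) :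
    ∫⁻ θ : Metric.sphere (0 : EuclideanSpace ℝ (Fin N)) 1,
      ENNReal.ofReal ((gaugeAt Ω y (σ • (θ : EuclideanSpace ℝ (Fin N))))⁻¹ ^ N)
        ∂(volume : Measure (EuclideanSpace ℝ (Fin N))).toSphere = N * volume Ω := by
  have : Nontrivial (EuclideanSpace ℝ (Fin N)) := by
    have : Nonempty (Fin N) := ⟨⟨0, hN⟩⟩
    infer_instance
  have hσ0 : σ ≠ 0 := by rcases hσ with rfl | rfl <;> norm_num
  have hγm := (gaugeAt_measurable hΩ hc).comp
    (measurable_prodMk_left (x := y) (β := EuclideanSpace ℝ (Fin N)))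
  have hγm' : Measurable fun v => gaugeAt Ω y (σ • v) := hγm.comp (measurable_const_smul σ)
  have h1 := measure_gauge_lt_one volume hγm'
    (fun x hx => gaugeAt_pos hΩ hb hy (smul_ne_zero hσ0 hx))
    (fun r x hr => by rw [smul_comm, gaugeAt_smul _ _ hr.le])
  rw [finrank_euclideanSpace_fin] at h1
  have h2 : volume {x | gaugeAt Ω y (σ • x) < 1} = volume Ω := by
    have e : {x | gaugeAt Ω y (σ • x) < 1} = (fun x => y + σ • x) ⁻¹' Ω := by
      ext x
      rw [mem_ofPred_eq, gaugeAt_lt_iff hΩ hc hy one_pos, inv_one, one_smul]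
      rfl
    rw [e]
    have : (fun x => y + σ • x) ⁻¹' Ω = (fun x => σ • x) ⁻¹' ((fun x => y + x) ⁻¹' Ω) := rfl
    rw [this, Measure.addHaar_preimage_smul _ hσ0, measure_preimage_add]
    rcases hσ with rfl | rfl <;> simp
  have hN0 : (0 : ℝ) < N := by exact_mod_cast hN
  rw [← h2, h1, ← ENNReal.ofReal_natCast, ← lintegral_const_mul' _ _ ENNReal.ofReal_ne_top]
  refine lintegral_congr fun θ => ?_
  rw [← ENNReal.ofReal_mul hN0.le]
  congr 1
  field_simp

/-- The Gaussian mean of the inverse `p`-th power of the half-length of the chords through a point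
of `Ω` is bounded below in terms of the volume of `Ω`. This is Jensen's inequality on the sphere,
in the form of an integrated tangent line inequality with contact point `Y₀ = |Ω| / a_N`, the
mean value of the `N`-th power of the exit time. -/
lemma le_lintegral_chordGauge (hN : 0 < N) {p : ℝ} (hp : 0 < p) (hΩ : IsOpen Ω)
    (hc : Convex ℝ Ω) (hb : Bornology.IsBounded Ω)
    {y : EuclideanSpace ℝ (Fin N)} (hy : y ∈ Ω) :
    ENNReal.ofReal (1 / 2 * Real.Gamma ((N + p) / 2) * (N * ballVol N *
        (ballVol N / (volume : Measure (EuclideanSpace ℝ (Fin N))).real Ω) ^ (p / N))) ≤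
      ∫⁻ v : EuclideanSpace ℝ (Fin N),
        ENNReal.ofReal (chordGauge Ω y v ^ p * Real.exp (-‖v‖ ^ 2)) := by
  have : Nontrivial (EuclideanSpace ℝ (Fin N)) := by
    have : Nonempty (Fin N) := ⟨⟨0, hN⟩⟩
    infer_instance
  have hN0 : (0 : ℝ) < N := by exact_mod_cast hN
  have hV : 0 < (volume : Measure (EuclideanSpace ℝ (Fin N))).real Ω :=
    ENNReal.toReal_pos (hΩ.measure_pos volume ⟨y, hy⟩).ne' hb.measure_lt_top.ne
  have hVt : volume Ω = ENNReal.ofReal ((volume : Measure (EuclideanSpace ℝ (Fin N))).real Ω) :=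
    (ofReal_measureReal hb.measure_lt_top.ne).symm
  have hB : 0 < ballVol N :=
    ENNReal.toReal_pos (Metric.measure_ball_pos volume _ one_pos).ne' measure_ball_lt_top.ne
  have hBt : volume (Metric.ball (0 : EuclideanSpace ℝ (Fin N)) 1) = ENNReal.ofReal (ballVol N) :=
    (ofReal_measureReal measure_ball_lt_top.ne).symm
  have hhm := (chordGauge_measurable hΩ hc).comp
    (measurable_prodMk_left (x := y) (β := EuclideanSpace ℝ (Fin N)))
  have hhm' : Measurable fun v => chordGauge Ω y v ^ p := Measurable.pow_const hhm p
  have hγm := (gaugeAt_measurable hΩ hc).comp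
    (measurable_prodMk_left (x := y) (β := EuclideanSpace ℝ (Fin N)))
  have hγm1 : Measurable fun θ : Metric.sphere (0 : EuclideanSpace ℝ (Fin N)) 1 =>
      gaugeAt Ω y ((1 : ℝ) • (θ : EuclideanSpace ℝ (Fin N))) :=
    hγm.comp (measurable_subtype_coe.const_smul (1 : ℝ))
  have hγm2 : Measurable fun θ : Metric.sphere (0 : EuclideanSpace ℝ (Fin N)) 1 =>
      gaugeAt Ω y ((-1 : ℝ) • (θ : EuclideanSpace ℝ (Fin N))) :=
    hγm.comp (measurable_subtype_coe.const_smul (-1 : ℝ))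
  have hγ0 : ∀ v, 0 ≤ chordGauge Ω y v := fun v => by
    have h1 := gaugeAt_nonneg (Ω := Ω) y v
    have h2 := gaugeAt_nonneg (Ω := Ω) y (-v)
    rw [chordGauge]
    positivity
  rw [lintegral_homogeneous_gaussian volume hp hhm' ?_, finrank_euclideanSpace_fin,
    ENNReal.ofReal_mul]
  rotate_left
  · have := Real.Gamma_pos_of_pos (show 0 < ((N : ℝ) + p) / 2 by positivity)
    positivity
  · intro r x hr
    have : chordGauge Ω y (r • x) = r * chordGauge Ω y x := by
      rw [chordGauge, chordGauge, ← smul_neg, gaugeAt_smul _ _ hr.le, gaugeAt_smul _ _ hr.le,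
        ← mul_add]
      field_simp
    rw [this, Real.mul_rpow hr.le (hγ0 x)]
  refine mul_le_mul_right ?_ _
  set V := (volume : Measure (EuclideanSpace ℝ (Fin N))).real Ω
  set Y₀ := V / ballVol N with hY₀
  have hY₀0 : 0 < Y₀ := by positivity
  set μ := (volume : Measure (EuclideanSpace ℝ (Fin N))).toSphere
  have hμ : μ univ = ENNReal.ofReal (N * ballVol N) := by
    rw [Measure.toSphere_apply_univ, finrank_euclideanSpace_fin, hBt,
      ENNReal.ofReal_mul hN0.le, ENNReal.ofReal_natCast]
  set A := ∫⁻ θ : Metric.sphere (0 : EuclideanSpace ℝ (Fin N)) 1,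
    ENNReal.ofReal (chordGauge Ω y θ ^ p) ∂μ
  set c := p / N * Y₀ ^ (-(p / N)) / Y₀ / 2 with hcdef
  have hc0 : 0 ≤ c := by positivity
  have e1 : (ballVol N / V) ^ (p / N) = Y₀ ^ (-(p / N)) := by
    rw [Real.rpow_neg hY₀0.le, ← Real.inv_rpow hY₀0.le, hY₀, inv_div]
  have hpt : ∀ θ : Metric.sphere (0 : EuclideanSpace ℝ (Fin N)) 1,
      ENNReal.ofReal ((1 + p / N) * Y₀ ^ (-(p / N))) ≤
        ENNReal.ofReal (chordGauge Ω y θ ^ p) +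
        (ENNReal.ofReal c * ENNReal.ofReal
            ((gaugeAt Ω y ((1 : ℝ) • (θ : EuclideanSpace ℝ (Fin N))))⁻¹ ^ N) +
          ENNReal.ofReal c * ENNReal.ofReal
            ((gaugeAt Ω y ((-1 : ℝ) • (θ : EuclideanSpace ℝ (Fin N))))⁻¹ ^ N)) := by
    intro θ
    have hθ : (θ : EuclideanSpace ℝ (Fin N)) ≠ 0 := ne_zero_of_mem_unit_sphere θ
    have h1 := gaugeAt_pos hΩ hb hy hθ
    have h2 := gaugeAt_pos hΩ hb hy (neg_ne_zero.2 hθ)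
    rw [one_smul, neg_one_smul, ← ENNReal.ofReal_mul hc0, ← ENNReal.ofReal_mul hc0,
      ← ENNReal.ofReal_add (by positivity) (by positivity),
      ← ENNReal.ofReal_add (Real.rpow_nonneg (hγ0 _) _) (by positivity)]
    exact ENNReal.ofReal_le_ofReal (chord_tangent_line hN hp h1 h2 hY₀0)
  have hI := lintegral_mono (μ := μ) hpt
  rw [lintegral_const, hμ, lintegral_add_left (by fun_prop), lintegral_add_left (by fun_prop),
    lintegral_const_mul' _ _ ENNReal.ofReal_ne_top,
    lintegral_const_mul' _ _ ENNReal.ofReal_ne_top,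
    lintegral_sphere_gaugeAt hN hΩ hc hb hy (Or.inl rfl),
    lintegral_sphere_gaugeAt hN hΩ hc hb hy (Or.inr rfl), hVt, ← ENNReal.ofReal_natCast,
    ← ENNReal.ofReal_mul hN0.le, ← ENNReal.ofReal_mul hc0,
    ← ENNReal.ofReal_mul (by positivity), ← ENNReal.ofReal_add (by positivity) (by positivity)]
    at hI
  have e2 : (1 + p / N) * Y₀ ^ (-(p / N)) * (N * ballVol N) =
      N * ballVol N * Y₀ ^ (-(p / N)) + (c * (N * V) + c * (N * V)) := by
    have hVY : V = Y₀ * ballVol N := by rw [hY₀]; field_simp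
    rw [hVY, hcdef]
    field_simp
    ring
  rw [e2, ENNReal.ofReal_add (by positivity) (by positivity),
    ENNReal.add_le_add_iff_right ENNReal.ofReal_ne_top] at hI
  rw [e1]
  exact hI

end Averages

/-! ### Test functions and passage to the closure -/

section TestFunctions

variable {N : ℕ} {Ω : Set (EuclideanSpace ℝ (Fin N))}

/-- The weight multiplying `|u|^p` on the right-hand side of the refined Hardy inequality. -/
noncomputable def hardyWeight (k : ℕ) (p e D : ℝ) (Ω : Set (EuclideanSpace ℝ (Fin N)))
    (x : EuclideanSpace ℝ (Fin N)) : ℝ :=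
  ((p - 1) / p) ^ p / bdryDist Ω x ^ p +
    1 / 2 * ((p - 1) / p) ^ (p - 1) * sumSq k (bdryDist Ω x / D) / bdryDist Ω x ^ p +
    kConst N p * (1 - e - aConst k p * e ^ 2) ^ (p / (p - 1)) *
      (ballVol N / (volume : Measure (EuclideanSpace ℝ (Fin N))).real Ω) ^ (p / N)

lemma kConst_nonneg {p : ℝ} (hp : 1 < p) : 0 ≤ kConst N p := by
  have h0 : 0 < p - 1 := by linarith
  have h1 := Real.Gamma_nonneg_of_nonneg (show 0 ≤ ((N : ℝ) + p) / 2 by positivity)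
  have h2 := Real.Gamma_nonneg_of_nonneg (show 0 ≤ (p + 1) / 2 by linarith)
  have h3 := Real.Gamma_nonneg_of_nonneg (show 0 ≤ (N : ℝ) / 2 by positivity)
  rw [kConst]
  positivity

lemma hardyWeight_measurable (k : ℕ) (p e D : ℝ) : Measurable (hardyWeight k p e D Ω) := by
  have h1 : Measurable (bdryDist Ω) := bdryDist_continuous.measurable
  have h2 := (sumSq_measurable k).comp (h1.div_const D)
  have h3 := h1.pow_const p
  exact (((measurable_const.div h3).add ((h2.const_mul _).div h3)).add_const _)

lemma gaussConst_mul_kConst (hN : 0 < N) {p : ℝ} (hp : 1 < p) :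
    gaussConst N p * kConst N p =
      (p - 1) * ((p - 1) / p) ^ p *
        (1 / 2 * Real.Gamma ((N + p) / 2) * (N * ballVol N)) := by
  obtain ⟨n, rfl⟩ : ∃ n, N = n + 1 := ⟨N - 1, by omega⟩
  have hN0 : (0 : ℝ) < (n + 1 : ℕ) := by positivity
  have h1 := (Real.Gamma_pos_of_pos (show 0 < (p + 1) / 2 by linarith)).ne'
  have h2 := (Real.Gamma_pos_of_pos (show 0 < ((n + 1 : ℕ) : ℝ) / 2 by positivity)).ne'
  rw [ballVol_eq hN, Real.Gamma_add_one (by positivity), gaussConst, kConst]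
  have h3 := hN0.ne'
  rw [Nat.add_sub_cancel, pow_succ]
  field_simp

/-- Averaging the directional weights over a Gaussian measure produces the full weight. -/
lemma gaussConst_mul_hardyWeight_le (hN : 0 < N) {k : ℕ} {p e D : ℝ} (hp : 1 < p)
    (hΩ : IsOpen Ω) (hc : Convex ℝ Ω) (hb : Bornology.IsBounded Ω)
    (hfr : (frontier Ω).Nonempty) (hg : 0 ≤ 1 - e - aConst k p * e ^ 2)
    {y : EuclideanSpace ℝ (Fin N)} (hy : y ∈ Ω) :
    ENNReal.ofReal (gaussConst N p * hardyWeight k p e D Ω y) ≤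
      ∫⁻ v : EuclideanSpace ℝ (Fin N),
        ENNReal.ofReal (dirWeight k p e D Ω y v * Real.exp (-‖v‖ ^ 2)) := by
  have hp0 : 0 < p := by linarith
  have hp1 : 0 < p - 1 := by linarith
  have hd := bdryDist_pos hΩ hfr hy
  have hS := sumSq_nonneg k (bdryDist Ω y / D)
  have hK := gaussConst_pos N hp0
  have hB : 0 ≤ ballVol N := ENNReal.toReal_nonneg
  have hG := (Real.Gamma_pos_of_pos (show 0 < ((N : ℝ) + p) / 2 by positivity)).le
  set c₁ := ((p - 1) / p) ^ p + 1 / 2 * ((p - 1) / p) ^ (p - 1) * sumSq k (bdryDist Ω y / D)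
    with hc₁
  set c₂ := (p - 1) * ((p - 1) / p) ^ p * (1 - e - aConst k p * e ^ 2) ^ (p / (p - 1)) with hc₂
  have h1 : 0 ≤ c₁ := by positivity
  have h2 : 0 ≤ c₂ := by positivity
  have hdg : ∀ v, 0 ≤ dirGauge Ω y v := fun v => le_max_of_le_left (gaugeAt_nonneg _ _)
  have hcg : ∀ v, 0 ≤ chordGauge Ω y v := fun v => by
    have h1 := gaugeAt_nonneg (Ω := Ω) y v
    have h2 := gaugeAt_nonneg (Ω := Ω) y (-v)
    rw [chordGauge]
    positivity
  have hdm : Measurable fun v => dirGauge Ω y v :=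
    (dirGauge_measurable hΩ hc).comp measurable_prodMk_left
  have e1 : gaussConst N p * hardyWeight k p e D Ω y =
      c₁ * (gaussConst N p / bdryDist Ω y ^ p) +
      c₂ * (1 / 2 * Real.Gamma ((N + p) / 2) * (N * ballVol N *
        (ballVol N / (volume : Measure (EuclideanSpace ℝ (Fin N))).real Ω) ^ (p / N))) := by
    have h3 := gaussConst_mul_kConst hN hp
    rw [hardyWeight, mul_add, ← mul_assoc, ← mul_assoc, h3, hc₁, hc₂]
    ring
  have e2 : ∀ v, dirWeight k p e D Ω y v * Real.exp (-‖v‖ ^ 2) =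
      c₁ * (dirGauge Ω y v ^ p * Real.exp (-‖v‖ ^ 2)) +
        c₂ * (chordGauge Ω y v ^ p * Real.exp (-‖v‖ ^ 2)) := fun v => by
    rw [dirWeight]
    ring
  have e3 : ∀ v, ENNReal.ofReal (dirWeight k p e D Ω y v * Real.exp (-‖v‖ ^ 2)) =
      ENNReal.ofReal c₁ * ENNReal.ofReal (dirGauge Ω y v ^ p * Real.exp (-‖v‖ ^ 2)) +
        ENNReal.ofReal c₂ *
          ENNReal.ofReal (chordGauge Ω y v ^ p * Real.exp (-‖v‖ ^ 2)) := fun v => by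
    have h3 := hdg v
    have h4 := hcg v
    rw [e2, ENNReal.ofReal_add (by positivity) (by positivity), ENNReal.ofReal_mul h1,
      ENNReal.ofReal_mul h2]
  simp only [e3]
  rw [lintegral_add_left (by fun_prop), lintegral_const_mul' _ _ ENNReal.ofReal_ne_top,
    lintegral_const_mul' _ _ ENNReal.ofReal_ne_top, e1,
    ENNReal.ofReal_add (by positivity) (by positivity), ENNReal.ofReal_mul h1,
    ENNReal.ofReal_mul h2]
  exact add_le_add
    (mul_le_mul_right (le_lintegral_dirGauge hN hp0 hΩ hc hb hfr hy) _)
    (mul_le_mul_right (le_lintegral_chordGauge hN hp0 hΩ hc hb hy) _)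

/-- The refined Hardy inequality for test functions. -/
lemma test_function_inequality (hN : 0 < N) {k : ℕ} {p e D : ℝ} (hp : 1 < p)
    (hΩ : IsOpen Ω) (hc : Convex ℝ Ω) (hb : Bornology.IsBounded Ω)
    (hfr : (frontier Ω).Nonempty) (hD : 0 < D)
    (hdD : Metric.diam Ω / 2 ≤ D) (hadm : IsAdmissible k p e)
    (he : etaD k (Metric.diam Ω) D ≤ e) (hg : 0 ≤ 1 - e - aConst k p * e ^ 2)
    {φ : EuclideanSpace ℝ (Fin N) → ℝ} (hφ : IsTestFunction Ω φ) :
    ∫⁻ y in Ω, ENNReal.ofReal (|φ y| ^ p * hardyWeight k p e D Ω y) ≤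
      ∫⁻ y in Ω, ENNReal.ofReal (‖gradient φ y‖ ^ p) := by
  have hp0 : 0 < p := by linarith
  have : Nontrivial (EuclideanSpace ℝ (Fin N)) := by
    have : Nonempty (Fin N) := ⟨⟨0, hN⟩⟩
    infer_instance
  have hK := gaussConst_pos N hp0
  have hφm : Measurable φ := hφ.smooth.continuous.measurable
  have hWm := dirWeight_measurable k p e D hΩ hc
  have hm1 : Measurable fun z : EuclideanSpace ℝ (Fin N) × EuclideanSpace ℝ (Fin N) =>
      ENNReal.ofReal (|φ z.1| ^ p * dirWeight k p e D Ω z.1 z.2) *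
        ENNReal.ofReal (Real.exp (-‖z.2‖ ^ 2)) :=
    ((((hφm.comp measurable_fst).abs.pow_const p).mul hWm).ennreal_ofReal).mul (by fun_prop)
  have hcf : Continuous fun z : EuclideanSpace ℝ (Fin N) × EuclideanSpace ℝ (Fin N) =>
      fderiv ℝ φ z.1 z.2 :=
    ((hφ.smooth.continuous_fderiv (by simp)).comp continuous_fst).clm_apply continuous_snd
  have hm2 : Measurable fun z : EuclideanSpace ℝ (Fin N) × EuclideanSpace ℝ (Fin N) =>
      ENNReal.ofReal (|fderiv ℝ φ z.1 z.2| ^ p) * ENNReal.ofReal (Real.exp (-‖z.2‖ ^ 2)) :=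
    ((hcf.measurable.abs.pow_const p).ennreal_ofReal).mul (by fun_prop)
  have key : ∫⁻ y in Ω, ∫⁻ v, ENNReal.ofReal (|φ y| ^ p * dirWeight k p e D Ω y v) *
        ENNReal.ofReal (Real.exp (-‖v‖ ^ 2)) ≤
      ∫⁻ y in Ω, ∫⁻ v, ENNReal.ofReal (|fderiv ℝ φ y v| ^ p) *
        ENNReal.ofReal (Real.exp (-‖v‖ ^ 2)) := by
    have hs1 := lintegral_lintegral_swap (μ := volume.restrict Ω) (ν := volume)
      (f := fun y v => ENNReal.ofReal (|φ y| ^ p * dirWeight k p e D Ω y v) *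
        ENNReal.ofReal (Real.exp (-‖v‖ ^ 2))) hm1.aemeasurable
    have hs2 := lintegral_lintegral_swap (μ := volume.restrict Ω) (ν := volume)
      (f := fun y v => ENNReal.ofReal (|fderiv ℝ φ y v| ^ p) *
        ENNReal.ofReal (Real.exp (-‖v‖ ^ 2))) hm2.aemeasurable
    rw [hs1, hs2]
    have h0 : ∀ᵐ v : EuclideanSpace ℝ (Fin N), v ≠ 0 := compl_mem_ae_iff.2 (measure_singleton 0)
    refine lintegral_mono_ae (h0.mono fun v hv => ?_)
    rw [lintegral_mul_const' _ _ ENNReal.ofReal_ne_top,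
      lintegral_mul_const' _ _ ENNReal.ofReal_ne_top]
    exact mul_le_mul_left
      (directional_inequality hp hΩ hc hb hD hdD hadm he hg hφ hv) _
  have hL : ENNReal.ofReal (gaussConst N p) *
      ∫⁻ y in Ω, ENNReal.ofReal (|φ y| ^ p * hardyWeight k p e D Ω y) ≤
      ∫⁻ y in Ω, ∫⁻ v, ENNReal.ofReal (|φ y| ^ p * dirWeight k p e D Ω y v) *
        ENNReal.ofReal (Real.exp (-‖v‖ ^ 2)) := by
    rw [← lintegral_const_mul' _ _ ENNReal.ofReal_ne_top]
    refine setLIntegral_mono' hΩ.measurableSet fun y hy => ?_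
    have h1 := gaussConst_mul_hardyWeight_le (D := D) hN hp hΩ hc hb hfr hg hy
    have h2 : 0 ≤ |φ y| ^ p := by positivity
    calc _ = ENNReal.ofReal (|φ y| ^ p) *
          ENNReal.ofReal (gaussConst N p * hardyWeight k p e D Ω y) := by
          rw [← ENNReal.ofReal_mul hK.le, ← ENNReal.ofReal_mul h2]
          congr 1
          ring
      _ ≤ ENNReal.ofReal (|φ y| ^ p) * ∫⁻ v : EuclideanSpace ℝ (Fin N),
          ENNReal.ofReal (dirWeight k p e D Ω y v * Real.exp (-‖v‖ ^ 2)) := mul_le_mul_right h1 _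
      _ = _ := by
          rw [← lintegral_const_mul' _ _ ENNReal.ofReal_ne_top]
          refine lintegral_congr fun v => ?_
          rw [ENNReal.ofReal_mul h2, ENNReal.ofReal_mul' (Real.exp_pos _).le, mul_assoc]
  have hR : ∫⁻ y in Ω, ∫⁻ v, ENNReal.ofReal (|fderiv ℝ φ y v| ^ p) *
        ENNReal.ofReal (Real.exp (-‖v‖ ^ 2)) =
      ENNReal.ofReal (gaussConst N p) * ∫⁻ y in Ω, ENNReal.ofReal (‖gradient φ y‖ ^ p) := by
    rw [← lintegral_const_mul' _ _ ENNReal.ofReal_ne_top]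
    refine lintegral_congr fun y => ?_
    rw [← ENNReal.ofReal_mul hK.le, ← lintegral_inner_gaussian hN hp0]
    refine lintegral_congr fun v => ?_
    rw [gradient, InnerProductSpace.toDual_symm_apply, ENNReal.ofReal_mul (by positivity)]
  rw [hR] at key
  exact (ENNReal.mul_le_mul_iff_right (ENNReal.ofReal_pos.2 hK).ne' ENNReal.ofReal_ne_top).1
    (hL.trans key)

end TestFunctions

section Density

variable {N : ℕ} {Ω : Set (EuclideanSpace ℝ (Fin N))}

lemma IsTestFunction.integrableOn_smul {φ : EuclideanSpace ℝ (Fin N) → ℝ}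
    (hφ : IsTestFunction Ω φ) {G : EuclideanSpace ℝ (Fin N) → EuclideanSpace ℝ (Fin N)}
    (hG : LocallyIntegrableOn G Ω volume) : Integrable (fun x => φ x • G x) := by
  have h1 : IntegrableOn G (tsupport φ) :=
    hG.integrableOn_compact_subset hφ.support_subset hφ.compactSupport
  have h2 : IntegrableOn (fun x => φ x • G x) (tsupport φ) :=
    h1.continuousOn_smul hφ.smooth.continuous.continuousOn hφ.compactSupport
  refine (integrableOn_iff_integrable_of_support_subset fun x hx => ?_).1 h2
  refine subset_tsupport φ fun h0 => hx ?_
  simp [h0]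

/-- Weak gradients are unique up to null sets. -/
lemma IsWeakGradient.ae_eq (hΩ : IsOpen Ω) {u : EuclideanSpace ℝ (Fin N) → ℝ}
    {G G' : EuclideanSpace ℝ (Fin N) → EuclideanSpace ℝ (Fin N)}
    (h : IsWeakGradient Ω u G) (h' : IsWeakGradient Ω u G') :
    G =ᵐ[volume.restrict Ω] G' := by
  have key := hΩ.ae_eq_zero_of_integral_contDiff_smul_eq_zero (f := G - G') (μ := volume)
    (h.locInt_grad.sub h'.locInt_grad) fun φ h1 h2 h3 => ?_
  · refine (ae_restrict_iff' hΩ.measurableSet).2 (key.mono fun x hx hxΩ => ?_)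
    exact sub_eq_zero.1 (hx hxΩ)
  · have hφ : IsTestFunction Ω φ := ⟨h1, h2, h3⟩
    have e : ∀ F : EuclideanSpace ℝ (Fin N) → EuclideanSpace ℝ (Fin N),
        ∫ x in Ω, φ x • F x = ∫ x, φ x • F x := fun F =>
      setIntegral_eq_integral_of_forall_compl_eq_zero fun x hx => by
        rw [image_eq_zero_of_notMem_tsupport fun h => hx (h3 h), zero_smul]
    have h4 := h.integral_eq φ hφ
    rw [h'.integral_eq φ hφ, neg_inj, e, e] at h4
    simp only [Pi.sub_apply, smul_sub]
    rw [integral_sub (hφ.integrableOn_smul h.locInt_grad)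
      (hφ.integrableOn_smul h'.locInt_grad), h4, sub_self]

lemma lintegral_norm_rpow_eq {F : Type*} [NormedAddCommGroup F]
    {μ : Measure (EuclideanSpace ℝ (Fin N))} {p : ℝ} (hp : 0 < p)
    (f : EuclideanSpace ℝ (Fin N) → F) :
    ∫⁻ x, ENNReal.ofReal (‖f x‖ ^ p) ∂μ = eLpNorm f (ENNReal.ofReal p) μ ^ p := by
  rw [eLpNorm_eq_lintegral_rpow_enorm_toReal (ENNReal.ofReal_pos.2 hp).ne' ENNReal.ofReal_ne_top,
    ENNReal.toReal_ofReal hp.le, ← ENNReal.rpow_mul, one_div_mul_cancel hp.ne', ENNReal.rpow_one]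
  refine lintegral_congr fun x => ?_
  rw [← ENNReal.ofReal_rpow_of_nonneg (norm_nonneg _) hp.le, ofReal_norm]

/-- A weighted inequality valid for test functions extends to `W_0^{1,p}`, by Fatou's lemma. -/
lemma MemW₀.lintegral_le {p : ℝ} (hp : 1 < p) (hΩ : IsOpen Ω)
    {w : EuclideanSpace ℝ (Fin N) → ℝ} (hw : Measurable w)
    (H : ∀ φ, IsTestFunction Ω φ → ∫⁻ y in Ω, ENNReal.ofReal (|φ y| ^ p * w y) ≤
      ∫⁻ y in Ω, ENNReal.ofReal (‖gradient φ y‖ ^ p))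
    {u : EuclideanSpace ℝ (Fin N) → ℝ}
    {G : EuclideanSpace ℝ (Fin N) → EuclideanSpace ℝ (Fin N)} (hu : MemW₀ p Ω u)
    (hG : IsWeakGradient Ω u G) :
    ∫⁻ y in Ω, ENNReal.ofReal (|u y| ^ p * w y) ≤ ∫⁻ y in Ω, ENNReal.ofReal (‖G y‖ ^ p) := by
  have hp0 : 0 < p := by linarith
  have hP : ENNReal.ofReal p ≠ 0 := (ENNReal.ofReal_pos.2 hp0).ne'
  have hP1 : 1 ≤ ENNReal.ofReal p := by
    rw [← ENNReal.ofReal_one]; exact ENNReal.ofReal_le_ofReal hp.le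
  obtain ⟨G', hG', hum, hGm, happ⟩ := hu
  have hGG : ∫⁻ y in Ω, ENNReal.ofReal (‖G y‖ ^ p) = ∫⁻ y in Ω, ENNReal.ofReal (‖G' y‖ ^ p) :=
    lintegral_congr_ae ((hG.ae_eq hΩ hG').mono fun y hy => by simp only [hy])
  rw [hGG, lintegral_norm_rpow_eq hp0]
  set μ := (volume : Measure (EuclideanSpace ℝ (Fin N))).restrict Ω
  have hε : ∀ n : ℕ, (0 : ℝ≥0∞) < ((n : ℝ≥0∞) + 1)⁻¹ := fun n => by
    simp
  choose φ hφ hφn using fun n : ℕ => happ _ (hε n)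
  have hlim : Filter.Tendsto (fun n : ℕ => ((n : ℝ≥0∞) + 1)⁻¹) Filter.atTop (nhds 0) := by
    have := ENNReal.tendsto_inv_nat_nhds_zero.comp (Filter.tendsto_add_atTop_nat 1)
    simpa [Function.comp_def] using this
  have hφm : ∀ n, AEStronglyMeasurable (φ n) μ := fun n =>
    (hφ n).smooth.continuous.aestronglyMeasurable
  have hgm : ∀ n, AEStronglyMeasurable (gradient (φ n)) μ := fun n => by
    have h := (hφ n).smooth.continuous_fderiv (by simp)
    exact ((InnerProductSpace.toDual ℝ
      (EuclideanSpace ℝ (Fin N))).symm.continuous.comp h).aestronglyMeasurable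
  have hconv : Filter.Tendsto (fun n => eLpNorm (φ n - u) (ENNReal.ofReal p) μ)
      Filter.atTop (nhds 0) := by
    refine tendsto_of_tendsto_of_tendsto_of_le_of_le tendsto_const_nhds hlim
      (fun n => zero_le) fun n => ?_
    rw [eLpNorm_sub_comm]
    exact le_self_add.trans (hφn n).le
  obtain ⟨ns, hns, hae⟩ := (tendstoInMeasure_of_tendsto_eLpNorm hP hφm
    hum.aestronglyMeasurable hconv).exists_seq_tendsto_ae
  have hbound : ∀ n, ∫⁻ y in Ω, ENNReal.ofReal (|φ n y| ^ p * w y) ≤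
      (eLpNorm G' (ENNReal.ofReal p) μ + ((n : ℝ≥0∞) + 1)⁻¹) ^ p := by
    intro n
    refine (H _ (hφ n)).trans ?_
    rw [lintegral_norm_rpow_eq hp0]
    refine ENNReal.rpow_le_rpow ?_ hp0.le
    have h1 : gradient (φ n) = G' - (G' - gradient (φ n)) := by abel
    have h2 : eLpNorm (G' - gradient (φ n)) (ENNReal.ofReal p) μ ≤ ((n : ℝ≥0∞) + 1)⁻¹ :=
      le_add_self.trans (hφn n).le
    rw [h1]
    refine (eLpNorm_sub_le hGm.aestronglyMeasurable
      (hGm.aestronglyMeasurable.sub (hgm n)) hP1).trans ?_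
    exact add_le_add_right h2 _
  have hlim2 : Filter.Tendsto
      (fun n => (eLpNorm G' (ENNReal.ofReal p) μ + ((ns n : ℝ≥0∞) + 1)⁻¹) ^ p)
      Filter.atTop (nhds (eLpNorm G' (ENNReal.ofReal p) μ ^ p)) := by
    have h1 := (tendsto_const_nhds (x := eLpNorm G' (ENNReal.ofReal p) μ)).add
      (hlim.comp hns.tendsto_atTop)
    rw [add_zero] at h1
    exact (ENNReal.continuous_rpow_const.tendsto _).comp h1
  calc ∫⁻ y in Ω, ENNReal.ofReal (|u y| ^ p * w y)
      = ∫⁻ y in Ω, Filter.liminf (fun n => ENNReal.ofReal (|φ (ns n) y| ^ p * w y))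
          Filter.atTop := by
        refine lintegral_congr_ae (hae.mono fun y hy => ?_)
        refine (Filter.Tendsto.liminf_eq ?_).symm
        refine ENNReal.tendsto_ofReal (Filter.Tendsto.mul_const _ ?_)
        exact hy.abs.rpow_const (Or.inr hp0.le)
    _ ≤ Filter.liminf (fun n => ∫⁻ y in Ω, ENNReal.ofReal (|φ (ns n) y| ^ p * w y))
          Filter.atTop := by
        refine lintegral_liminf_le fun n => ?_
        have := (hφ (ns n)).smooth.continuous.measurable
        fun_prop
    _ ≤ Filter.liminf (fun n => (eLpNorm G' (ENNReal.ofReal p) μ + ((ns n : ℝ≥0∞) + 1)⁻¹) ^ p)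
          Filter.atTop := Filter.liminf_le_liminf (Filter.Eventually.of_forall fun n => hbound _)
    _ = _ := hlim2.liminf_eq

/-- The right-hand side of the refined Hardy inequality as a single weighted integral. -/
lemma refinedHardyIneq_iff {k : ℕ} {p D : ℝ} (hp : 1 < p)
    (hg : 0 ≤ 1 - etaD k (Metric.diam Ω) D - aConst k p * etaD k (Metric.diam Ω) D ^ 2)
    {u : EuclideanSpace ℝ (Fin N) → ℝ}
    {G : EuclideanSpace ℝ (Fin N) → EuclideanSpace ℝ (Fin N)}
    (hu : AEMeasurable u (volume.restrict Ω)) :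
    RefinedHardyIneq k p D Ω u G ↔
      ∫⁻ y in Ω, ENNReal.ofReal
        (|u y| ^ p * hardyWeight k p (etaD k (Metric.diam Ω) D) D Ω y) ≤
      ∫⁻ y in Ω, ENNReal.ofReal (‖G y‖ ^ p) := by
  have hp1 : 0 < p - 1 := by linarith
  have hp0 : 0 < p := by linarith
  have hdm : Measurable (bdryDist Ω) := bdryDist_continuous.measurable
  have hd0 : ∀ y, 0 ≤ bdryDist Ω y := fun y => Metric.infDist_nonneg
  have hB : 0 ≤ ballVol N := ENNReal.toReal_nonneg
  have hk := kConst_nonneg (N := N) hp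
  have hPm : ∀ i, Measurable fun y => prodX i (bdryDist Ω y / D) := fun i =>
    (prodX_measurable i).comp (hdm.div_const D)
  set e := etaD k (Metric.diam Ω) D
  set A := ((p - 1) / p) ^ p
  set B := 1 / 2 * ((p - 1) / p) ^ (p - 1)
  set C := kConst N p * (1 - e - aConst k p * e ^ 2) ^ (p / (p - 1)) *
    (ballVol N / (volume : Measure (EuclideanSpace ℝ (Fin N))).real Ω) ^ (p / N) with hC
  have hA0 : 0 ≤ A := by positivity
  have hB0 : 0 ≤ B := by positivity
  have hC0 : 0 ≤ C := by positivity
  have hprod : ∀ i y, ∏ j ∈ Finset.Icc 1 i, (X j (bdryDist Ω y / D)) ^ 2 =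
      prodX i (bdryDist Ω y / D) ^ 2 := fun i y => Finset.prod_pow _ _ _
  have key : ∫⁻ y in Ω, ENNReal.ofReal (|u y| ^ p * hardyWeight k p e D Ω y) =
      ENNReal.ofReal A * (∫⁻ y in Ω, ENNReal.ofReal (|u y| ^ p / bdryDist Ω y ^ p)) +
      ENNReal.ofReal B * (∑ i ∈ Finset.Icc 1 k, ∫⁻ y in Ω, ENNReal.ofReal
        (|u y| ^ p / bdryDist Ω y ^ p * prodX i (bdryDist Ω y / D) ^ 2)) +
      ENNReal.ofReal C * ∫⁻ y in Ω, ENNReal.ofReal (|u y| ^ p) := by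
    have hum : AEMeasurable (fun y => |u y| ^ p) (volume.restrict Ω) := by fun_prop
    have hud : AEMeasurable (fun y => |u y| ^ p / bdryDist Ω y ^ p) (volume.restrict Ω) :=
      hum.div (hdm.pow_const p).aemeasurable
    have hui : ∀ i, AEMeasurable (fun y => ENNReal.ofReal
        (|u y| ^ p / bdryDist Ω y ^ p * prodX i (bdryDist Ω y / D) ^ 2)) (volume.restrict Ω) :=
      fun i => (hud.mul ((hPm i).pow_const 2).aemeasurable).ennreal_ofReal
    rw [← lintegral_finsetSum' _ (fun i _ => hui i),
      ← lintegral_const_mul' _ _ ENNReal.ofReal_ne_top,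
      ← lintegral_const_mul' _ _ ENNReal.ofReal_ne_top,
      ← lintegral_const_mul' _ _ ENNReal.ofReal_ne_top,
      ← lintegral_add_left' (hud.ennreal_ofReal.const_mul _),
      ← lintegral_add_right' _ (hum.ennreal_ofReal.const_mul _)]
    refine lintegral_congr fun y => ?_
    have h1 : 0 ≤ |u y| ^ p / bdryDist Ω y ^ p :=
      div_nonneg (by positivity) (Real.rpow_nonneg (hd0 y) _)
    have hS := sumSq_nonneg k (bdryDist Ω y / D)
    rw [← ENNReal.ofReal_sum_of_nonneg fun i _ => mul_nonneg h1 (sq_nonneg _), ← Finset.mul_sum,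
      ← ENNReal.ofReal_mul hA0, ← ENNReal.ofReal_mul hB0, ← ENNReal.ofReal_mul hC0]
    have h2 : ∑ i ∈ Finset.Icc 1 k, prodX i (bdryDist Ω y / D) ^ 2 =
      sumSq k (bdryDist Ω y / D) := rfl
    rw [h2, ← ENNReal.ofReal_add (by positivity) (by positivity),
      ← ENNReal.ofReal_add (by positivity) (by positivity)]
    congr 1
    rw [hardyWeight, ← hC]
    ring
  rw [RefinedHardyIneq, ge_iff_le]
  simp only [hprod]
  rw [key]

end Density

/-- The refined Hardy inequality for all parameters `D` at which `η_D` is admissible. -/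
lemma refinedHardyIneq_of_isAdmissible {N k : ℕ} {p D δ : ℝ} (hp : 1 < p) (hδ : 0 < δ)
    (hD : δ / 2 ≤ D) (hadm : IsAdmissible k p (etaD k δ D))
    {Ω : Set (EuclideanSpace ℝ (Fin N))} (hΩ : IsOpen Ω) (hc : Convex ℝ Ω)
    (hb : Bornology.IsBounded Ω) (hdiam : Metric.diam Ω = δ)
    {u : EuclideanSpace ℝ (Fin N) → ℝ}
    {G : EuclideanSpace ℝ (Fin N) → EuclideanSpace ℝ (Fin N)} (hu : MemW₀ p Ω u)
    (hG : IsWeakGradient Ω u G) : RefinedHardyIneq k p D Ω u G := by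
  have hns : ¬ Ω.Subsingleton := fun h => by
    rw [Metric.diam_subsingleton h] at hdiam
    exact hδ.ne hdiam
  have hN : 0 < N := by
    refine Nat.pos_of_ne_zero fun h => hns ?_
    subst h
    exact subsingleton_of_subsingleton
  have hnt : Nontrivial (EuclideanSpace ℝ (Fin N)) := by
    have : Nonempty (Fin N) := ⟨⟨0, hN⟩⟩
    infer_instance
  have hfr : (frontier Ω).Nonempty := by
    refine nonempty_frontier_iff.2 ⟨?_, fun h => ?_⟩
    · exact (not_subsingleton_iff.1 hns).nonempty
    · rw [h] at hb
      exact NormedSpace.unbounded_univ ℝ (EuclideanSpace ℝ (Fin N)) hb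
  have hDpos : 0 < D := by linarith
  have hg : 0 ≤ 1 - etaD k δ D - aConst k p * etaD k δ D ^ 2 :=
    hadm.defect_nonneg (div_two_mul_mem_Ioc hδ hD) le_rfl
  subst hdiam
  refine (refinedHardyIneq_iff hp hg ?_).2 ?_
  · obtain ⟨_, _, hum, _⟩ := hu
    exact hum.aestronglyMeasurable.aemeasurable
  · exact hu.lintegral_le hp hΩ (hardyWeight_measurable k p _ D) (fun φ hφ =>
      test_function_inequality hN hp hΩ hc hb hfr hDpos hD hadm le_rfl hg hφ) hG

end RefinedHardy

theorem theoremA (k : ℕ) (p : ℝ) (hp : 1 < p) (δ : ℝ) (hδ : 0 < δ) :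
    -- some threshold depending only on `k`, `p` and the diameter `δ`
    (∃ D₀ : ℝ, δ / 2 ≤ D₀ ∧ ∀ D : ℝ, D₀ ≤ D →
      0 ≤ 1 - RefinedHardy.etaD k δ D
          - RefinedHardy.aConst k p * RefinedHardy.etaD k δ D ^ 2 ∧
      ∀ (N : ℕ) (Ω : Set (EuclideanSpace ℝ (Fin N))),
        IsOpen Ω → Convex ℝ Ω → Bornology.IsBounded Ω → Metric.diam Ω = δ →
        ∀ (u : EuclideanSpace ℝ (Fin N) → ℝ)
          (G : EuclideanSpace ℝ (Fin N) → EuclideanSpace ℝ (Fin N)),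
          RefinedHardy.MemW₀ p Ω u → RefinedHardy.IsWeakGradient Ω u G →
          RefinedHardy.RefinedHardyIneq k p D Ω u G) ∧
    -- for `p = 2` the threshold is the unique solution of `η_{D₀} = 1`
    (p = 2 → 1 ≤ k → ∃ D₀ : ℝ,
      (δ / 2 ≤ D₀ ∧ RefinedHardy.etaD k δ D₀ = 1) ∧
      (∀ D : ℝ, δ / 2 ≤ D → RefinedHardy.etaD k δ D = 1 → D = D₀) ∧
      ∀ D : ℝ, D₀ ≤ D →
        0 ≤ 1 - RefinedHardy.etaD k δ D
            - RefinedHardy.aConst k p * RefinedHardy.etaD k δ D ^ 2 ∧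
        ∀ (N : ℕ) (Ω : Set (EuclideanSpace ℝ (Fin N))),
          IsOpen Ω → Convex ℝ Ω → Bornology.IsBounded Ω → Metric.diam Ω = δ →
          ∀ (u : EuclideanSpace ℝ (Fin N) → ℝ)
            (G : EuclideanSpace ℝ (Fin N) → EuclideanSpace ℝ (Fin N)),
            RefinedHardy.MemW₀ p Ω u → RefinedHardy.IsWeakGradient Ω u G →
            RefinedHardy.RefinedHardyIneq k p D Ω u G) := by
  -- `η_D` decreases in `D`, so every `D ≥ D₀` is admissible as soon as `D₀` is.
  have main : ∀ D₀, δ / 2 ≤ D₀ → RefinedHardy.IsAdmissible k p (RefinedHardy.etaD k δ D₀) →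
      ∀ D, D₀ ≤ D →
        0 ≤ 1 - RefinedHardy.etaD k δ D
            - RefinedHardy.aConst k p * RefinedHardy.etaD k δ D ^ 2 ∧
        ∀ (N : ℕ) (Ω : Set (EuclideanSpace ℝ (Fin N))),
          IsOpen Ω → Convex ℝ Ω → Bornology.IsBounded Ω → Metric.diam Ω = δ →
          ∀ (u : EuclideanSpace ℝ (Fin N) → ℝ)
            (G : EuclideanSpace ℝ (Fin N) → EuclideanSpace ℝ (Fin N)),
            RefinedHardy.MemW₀ p Ω u → RefinedHardy.IsWeakGradient Ω u G →
            RefinedHardy.RefinedHardyIneq k p D Ω u G := by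
    intro D₀ hD₀ hadm D hD
    have hδD : δ / 2 ≤ D := hD₀.trans hD
    have hadm' := hadm.mono (RefinedHardy.etaD_antitoneOn k hδ hD₀ hδD hD)
    exact ⟨hadm'.defect_nonneg (RefinedHardy.div_two_mul_mem_Ioc hδ hδD) le_rfl,
      fun N Ω hΩ hc hb hdiam u G hu hG =>
        RefinedHardy.refinedHardyIneq_of_isAdmissible hp hδ hδD hadm' hΩ hc hb hdiam hu hG⟩
  refine ⟨?_, fun hp2 hk => ?_⟩
  · obtain ⟨e, he0, he⟩ := RefinedHardy.exists_isAdmissible (k := k) hp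
    obtain ⟨D₀, hD₀, hD₀e⟩ := RefinedHardy.exists_etaD_le k hδ he0
    exact ⟨D₀, hD₀, main D₀ hD₀ (he.mono hD₀e)⟩
  · obtain ⟨D₀, hD₀, huniq⟩ := RefinedHardy.exists_etaD_eq_one hk hδ
    refine ⟨D₀, hD₀, huniq, main D₀ hD₀.1 ?_⟩
    rw [hD₀.2]
    exact RefinedHardy.isAdmissible_one_of_le_two hp hp2.le
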